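/- Let $(M^6,g)$ be a smooth Riemannian manifold of dimension six with Levi-Civita connection $\nabla$, and let $J$ be a smooth almost complex structure on $M$ with $g(JX,JY)=g(X,Y)$. Assume that $(M,J,g)$ is strict nearly Kähler, that is, $(\nabla_XJ)X=0$ for all $X\in TM$, and $\nabla_XJ\neq0$ for all $X\in TM$ with $X\neq0$. Let $T$ be the torsion of the canonical connection $\overline\nabla_XY=\nabla_XY-\tfrac12J(\nabla_XJ)Y$. Let $f:L^3\to M^6$ be a smooth Lagrangian immersion of a smooth manifold of dimension three, that is, an immersion with $g(J\,df(X),df(Y))=0$ for all $X,Y\in T_pL$, $p\in L$. We identify $T_pL$ with $df(T_pL)$ and give $L$ the induced metric. Let $II$ be the second fundamental form of $f$, and for $p \in L$ and an orthonormal basis $e_1,e_2,e_3$ of $T_pL$ put $$\alpha(X,Y)=\sum_{i=1}^3\big\langle II(e_i,X),\,J\,T(e_i,Y)\big\rangle\quad(X,Y\in T_pL),\qquad \overrightarrow H=\sum_{i=1}^3II(e_i,e_i).$$ Then $\alpha=0$ and $\overrightarrow H=0$ at every point of $L$. In particular, $L$ is orientable and the immersion $f$ is minimal. -/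

import Mathlib

open Bundle VectorField Manifold
open scoped Manifold ContDiff Topology

set_option linter.unusedSectionVars false

namespace NearlyKahler

section LeviCivita

instance finiteDimensional_tangentSpace {E : Type*} [NormedAddCommGroup E] [NormedSpace ℝ E] [FiniteDimensional ℝ E]
    {H : Type*} [TopologicalSpace H] (I : ModelWithCorners ℝ E H)
    {M : Type*} [TopologicalSpace M] [ChartedSpace H M] (x : M) :
    FiniteDimensional ℝ (TangentSpace I x) :=
  inferInstanceAs (FiniteDimensional ℝ E)

variable {E : Type*} [NormedAddCommGroup E] [NormedSpace ℝ E] [FiniteDimensional ℝ E]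
  {H : Type*} [TopologicalSpace H] {I : ModelWithCorners ℝ E H}
  {M : Type*} [TopologicalSpace M] [ChartedSpace H M] [IsManifold I ∞ M]
  [RiemannianBundle (fun x : M => TangentSpace I x)]

/-- The right-hand side of the Koszul formula for `2⟨∇_X Y, Z⟩`:
`X⟨Y,Z⟩ + Y⟨Z,X⟩ - Z⟨X,Y⟩ + ⟨[X,Y],Z⟩ - ⟨[Y,Z],X⟩ + ⟨[Z,X],Y⟩` at the point `x`. -/
noncomputable def koszul (Y X Z : Π x : M, TangentSpace I x) (x : M) : ℝ :=
  mvfderiv I (fun y => inner ℝ (Y y) (Z y)) x (X x)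
  + mvfderiv I (fun y => inner ℝ (Z y) (X y)) x (Y x)
  - mvfderiv I (fun y => inner ℝ (X y) (Y y)) x (Z x)
  + inner ℝ (mlieBracket I X Y x) (Z x)
  - inner ℝ (mlieBracket I Y Z x) (X x)
  + inner ℝ (mlieBracket I Z X x) (Y x)

variable [IsContMDiffRiemannianBundle I ∞ E (fun x : M => TangentSpace I x)]

variable {x : M} {X Y Z : Π x : M, TangentSpace I x}

lemma mdiff_inner (hY : MDiffAt (T% Y) x) (hZ : MDiffAt (T% Z) x) :
    MDifferentiableAt I 𝓘(ℝ, ℝ) (fun y => (inner ℝ (Y y) (Z y) : ℝ)) x :=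
  MDifferentiableAt.inner_bundle hY hZ

lemma koszul_tensorial₁ (hY : MDiffAt (T% Y) x) (hZ : MDiffAt (T% Z) x) :
    TensorialAt I E (fun X => koszul Y X Z x) x where
  smul {f X} hf hX := by
    have h1 : (fun y => (inner ℝ (Z y) ((f • X) y) : ℝ)) = fun y => f y * inner ℝ (Z y) (X y) := by
      ext y; simp [inner_smul_right]
    have h2 : (fun y => (inner ℝ ((f • X) y) (Y y) : ℝ)) = fun y => f y * inner ℝ (X y) (Y y) := by
      ext y; simp [inner_smul_left]
    simp only [koszul, h1, h2, mvfderiv_fun_mul hf (mdiff_inner hZ hX), mvfderiv_fun_mul hf (mdiff_inner hX hY),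
     mlieBracket_smul_left hf hX, mlieBracket_smul_right hf hX]
    simp [inner_add_left, inner_smul_left, inner_smul_right]
    rw [real_inner_comm (X x) (Z x)]
    ring
  add {X X'} hX hX' := by
    have h1 : (fun y => (inner ℝ (Z y) ((X + X') y) : ℝ)) = fun y => inner ℝ (Z y) (X y) + inner ℝ (Z y) (X' y) := by
      ext y; simp [inner_add_right]
    have h2 : (fun y => (inner ℝ ((X + X') y) (Y y) : ℝ)) = fun y => inner ℝ (X y) (Y y) + inner ℝ (X' y) (Y y) := by
      ext y; simp [inner_add_left]
    simp only [koszul, h1, h2, mvfderiv_fun_add (mdiff_inner hZ hX) (mdiff_inner hZ hX'),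
     mvfderiv_fun_add (mdiff_inner hX hY) (mdiff_inner hX' hY),
     mlieBracket_add_left hX hX', mlieBracket_add_right hX hX']
    simp [inner_add_left, inner_add_right]
    ring

lemma koszul_tensorial₂ (hY : MDiffAt (T% Y) x) (hX : MDiffAt (T% X) x) :
    TensorialAt I E (fun Z => koszul Y X Z x) x where
  smul {f Z} hf hZ := by
    have h1 : (fun y => (inner ℝ (Y y) ((f • Z) y) : ℝ)) = fun y => f y * inner ℝ (Y y) (Z y) := by
      ext y; simp [inner_smul_right]
    have h2 : (fun y => (inner ℝ ((f • Z) y) (X y) : ℝ)) = fun y => f y * inner ℝ (Z y) (X y) := by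
      ext y; simp [inner_smul_left]
    simp only [koszul, h1, h2, mvfderiv_fun_mul hf (mdiff_inner hZ hX),
      mvfderiv_fun_mul hf (mdiff_inner hY hZ),
      mlieBracket_smul_left hf hZ, mlieBracket_smul_right hf hZ]
    simp [inner_add_left, inner_smul_left, inner_smul_right]
    rw [real_inner_comm (Y x) (Z x), real_inner_comm (X x) (Z x)]
    ring
  add {Z Z'} hZ hZ' := by
    have h1 : (fun y => (inner ℝ (Y y) ((Z + Z') y) : ℝ)) =
        fun y => inner ℝ (Y y) (Z y) + inner ℝ (Y y) (Z' y) := by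
      ext y; simp [inner_add_right]
    have h2 : (fun y => (inner ℝ ((Z + Z') y) (X y) : ℝ)) =
        fun y => inner ℝ (Z y) (X y) + inner ℝ (Z' y) (X y) := by
      ext y; simp [inner_add_left]
    simp only [koszul, h1, h2, mvfderiv_fun_add (mdiff_inner hZ hX) (mdiff_inner hZ' hX),
      mvfderiv_fun_add (mdiff_inner hY hZ) (mdiff_inner hY hZ'),
      mlieBracket_add_left hZ hZ', mlieBracket_add_right hZ hZ']
    simp [inner_add_left, inner_add_right]
    ring

lemma koszul_add {Y' : Π x : M, TangentSpace I x} (hX : MDiffAt (T% X) x) (hY : MDiffAt (T% Y) x)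
    (hY' : MDiffAt (T% Y') x) (hZ : MDiffAt (T% Z) x) :
    koszul (Y + Y') X Z x = koszul Y X Z x + koszul Y' X Z x := by
  have h1 : (fun y => (inner ℝ ((Y + Y') y) (Z y) : ℝ)) =
      fun y => inner ℝ (Y y) (Z y) + inner ℝ (Y' y) (Z y) := by
    ext y; simp [inner_add_left]
  have h2 : (fun y => (inner ℝ (X y) ((Y + Y') y) : ℝ)) =
      fun y => inner ℝ (X y) (Y y) + inner ℝ (X y) (Y' y) := by
    ext y; simp [inner_add_right]
  simp only [koszul, h1, h2, mvfderiv_fun_add (mdiff_inner hX hY) (mdiff_inner hX hY'),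
    mvfderiv_fun_add (mdiff_inner hY hZ) (mdiff_inner hY' hZ),
    mlieBracket_add_left hY hY', mlieBracket_add_right hY hY']
  simp [inner_add_left, inner_add_right]
  ring

lemma koszul_smul {f : M → ℝ} (hf : MDiffAt f x) (hX : MDiffAt (T% X) x)
    (hY : MDiffAt (T% Y) x) (hZ : MDiffAt (T% Z) x) :
    koszul (f • Y) X Z x =
      f x * koszul Y X Z x + 2 * (mvfderiv I f x (X x) * inner ℝ (Y x) (Z x)) := by
  have h1 : (fun y => (inner ℝ ((f • Y) y) (Z y) : ℝ)) = fun y => f y * inner ℝ (Y y) (Z y) := by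
    ext y; simp [inner_smul_left]
  have h2 : (fun y => (inner ℝ (X y) ((f • Y) y) : ℝ)) = fun y => f y * inner ℝ (X y) (Y y) := by
    ext y; simp [inner_smul_right]
  simp only [koszul, h1, h2, mvfderiv_fun_mul hf (mdiff_inner hX hY),
    mvfderiv_fun_mul hf (mdiff_inner hY hZ),
    mlieBracket_smul_left hf hY, mlieBracket_smul_right hf hY]
  simp [inner_add_left, inner_smul_left, inner_smul_right]
  rw [real_inner_comm (X x) (Y x)]
  ring

open Classical in
/-- The bilinear form `(v, z) ↦ 2⟨∇_v Y, z⟩` on `T_x M`. -/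
noncomputable def koszulForm (Y : Π x : M, TangentSpace I x) (x : M) :
    TangentSpace I x →L[ℝ] TangentSpace I x →L[ℝ] ℝ :=
  if hY : MDiffAt (T% Y) x then
    TensorialAt.mkHom₂ (fun X Z => koszul Y X Z x) x
      (fun _ hZ => koszul_tensorial₁ hY hZ) (fun _ hX => koszul_tensorial₂ hY hX)
  else 0

lemma koszulForm_apply (hX : MDiffAt (T% X) x) (hY : MDiffAt (T% Y) x) (hZ : MDiffAt (T% Z) x) :
    koszulForm Y x (X x) (Z x) = koszul Y X Z x := by
  rw [koszulForm, dif_pos hY]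
  exact TensorialAt.mkHom₂_apply (Φ := fun X Z => koszul Y X Z x)
    (fun _ hZ => koszul_tensorial₁ hY hZ) (fun _ hX => koszul_tensorial₂ hY hX) hX hZ

/-- The endomorphism `v ↦ ∇_v Y` of `T_x M` determined by `2⟨∇_v Y, z⟩ = koszulForm Y x v z`
(and `0` if `Y` is not differentiable at `x`). -/
noncomputable def leviCivitaFun (Y : Π x : M, TangentSpace I x) (x : M) :
    TangentSpace I x →L[ℝ] TangentSpace I x :=
  LinearMap.toContinuousLinearMap
    { toFun := fun v => (1 / 2 : ℝ) •
        (InnerProductSpace.toDual ℝ (TangentSpace I x)).symm (koszulForm Y x v)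
      map_add' := by intro v w; simp
      map_smul' := by intro c v; simp [smul_comm c] }

lemma inner_leviCivitaFun (hX : MDiffAt (T% X) x) (hY : MDiffAt (T% Y) x)
    (hZ : MDiffAt (T% Z) x) :
    2 * inner ℝ (leviCivitaFun Y x (X x)) (Z x) = koszul Y X Z x := by
  rw [← koszulForm_apply hX hY hZ]
  simp [leviCivitaFun, inner_smul_left]

lemma ext_inner_field {v w : TangentSpace I x}
    (h : ∀ Z : Π x : M, TangentSpace I x, MDiffAt (T% Z) x →
      inner ℝ v (Z x) = (inner ℝ w (Z x) : ℝ)) : v = w := by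
  refine ext_inner_right ℝ fun z => ?_
  have := h (FiberBundle.extend E z) (FiberBundle.mdifferentiableAt_extend I E z)
  rwa [FiberBundle.extend_apply_self] at this

lemma ext_field {A B : TangentSpace I x →L[ℝ] TangentSpace I x}
    (h : ∀ X : Π x : M, TangentSpace I x, MDiffAt (T% X) x → A (X x) = B (X x)) : A = B := by
  ext1 v
  have := h (FiberBundle.extend E v) (FiberBundle.mdifferentiableAt_extend I E v)
  rwa [FiberBundle.extend_apply_self] at this

variable (I M) in
/-- The Levi-Civita connection of the Riemannian manifold `M`; `leviCivita I M Y x v` is `∇_v Y`.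
That it is the unique metric and torsion-free connection is proved below. -/
noncomputable def leviCivita : CovariantDerivative I E (fun x : M => TangentSpace I x) where
  toFun := leviCivitaFun
  isCovariantDerivativeOnUniv :=
    { add := by
        intro Y Y' x hY hY' _
        refine ext_field fun X hX => ext_inner_field fun Z hZ => ?_
        have h := inner_leviCivitaFun hX (mdifferentiableAt_add_section hY hY') hZ
        rw [koszul_add hX hY hY' hZ, ← inner_leviCivitaFun hX hY hZ,
          ← inner_leviCivitaFun hX hY' hZ] at h
        rw [add_apply, inner_add_left]
        linarith
      leibniz := by
        intro Y f x hY hf _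
        refine ext_field fun X hX => ext_inner_field fun Z hZ => ?_
        have h := inner_leviCivitaFun hX (hf.smul_section hY) hZ
        rw [koszul_smul hf hX hY hZ, ← inner_leviCivitaFun hX hY hZ] at h
        rw [add_apply, inner_add_left]
        simp [inner_smul_left]
        linarith }

lemma inner_fun_comm (X Y : Π x : M, TangentSpace I x) :
    (fun y => (inner ℝ (X y) (Y y) : ℝ)) = fun y => inner ℝ (Y y) (X y) :=
  funext fun _ => real_inner_comm _ _

theorem leviCivita_metric (hX : MDiffAt (T% X) x) (hY : MDiffAt (T% Y) x)
    (hZ : MDiffAt (T% Z) x) :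
    mvfderiv I (fun y => inner ℝ (Y y) (Z y)) x (X x) =
      inner ℝ (leviCivita I M Y x (X x)) (Z x) + inner ℝ (Y x) (leviCivita I M Z x (X x)) := by
  have h1 : 2 * inner ℝ (leviCivita I M Y x (X x)) (Z x) = koszul Y X Z x :=
    inner_leviCivitaFun hX hY hZ
  have h2 : 2 * inner ℝ (leviCivita I M Z x (X x)) (Y x) = koszul Z X Y x :=
    inner_leviCivitaFun hX hZ hY
  rw [real_inner_comm _ (Y x)]
  simp only [koszul, inner_fun_comm Z Y, inner_fun_comm Z X, inner_fun_comm Y X] at h1 h2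
  rw [mlieBracket_swap_apply (V := Y) (W := X), mlieBracket_swap_apply (V := Z) (W := Y),
    inner_neg_left, inner_neg_left] at h2
  rw [mlieBracket_swap_apply (V := Z) (W := X), inner_neg_left] at h1
  linarith

theorem leviCivita_torsion : (leviCivita I M).torsion = 0 := by
  rw [CovariantDerivative.torsion_eq_zero_iff]
  intro X Y x hX hY
  refine ext_inner_field fun Z hZ => ?_
  have h1 : 2 * inner ℝ (leviCivita I M Y x (X x)) (Z x) = koszul Y X Z x :=
    inner_leviCivitaFun hX hY hZ
  have h2 : 2 * inner ℝ (leviCivita I M X x (Y x)) (Z x) = koszul X Y Z x :=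
    inner_leviCivitaFun hY hX hZ
  rw [inner_sub_left]
  simp only [koszul, inner_fun_comm Z Y, inner_fun_comm Z X, inner_fun_comm Y X] at h1 h2
  rw [mlieBracket_swap_apply (V := Y) (W := X), mlieBracket_swap_apply (V := Z) (W := Y),
    inner_neg_left, inner_neg_left] at h2
  rw [mlieBracket_swap_apply (V := Z) (W := X), inner_neg_left] at h1
  linarith

/-- Every metric torsion-free connection is the Levi-Civita connection. -/
theorem leviCivita_unique (D : CovariantDerivative I E (fun x : M => TangentSpace I x))
    (hg : ∀ {x : M} {X Y Z : Π x : M, TangentSpace I x}, MDiffAt (T% X) x → MDiffAt (T% Y) x →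
      MDiffAt (T% Z) x → mvfderiv I (fun y => inner ℝ (Y y) (Z y)) x (X x) =
        inner ℝ (D Y x (X x)) (Z x) + inner ℝ (Y x) (D Z x (X x)))
    (hT : D.torsion = 0) (hY : MDiffAt (T% Y) x) : D Y x = leviCivita I M Y x := by
  rw [CovariantDerivative.torsion_eq_zero_iff] at hT
  refine ext_field fun X hX => ext_inner_field fun Z hZ => ?_
  have h : 2 * inner ℝ (leviCivita I M Y x (X x)) (Z x) = koszul Y X Z x :=
    inner_leviCivitaFun hX hY hZ
  simp only [koszul, hg hX hY hZ, hg hY hZ hX, hg hZ hX hY, ← hT hX hY, ← hT hY hZ, ← hT hZ hX,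
    inner_sub_left] at h
  have e1 := real_inner_comm (Y x) (D Z x (X x))
  have e2 := real_inner_comm (Z x) (D X x (Y x))
  have e3 := real_inner_comm (X x) (D Y x (Z x))
  linarith

end LeviCivita

section AlmostHermitian

variable {E : Type*} [NormedAddCommGroup E] [NormedSpace ℝ E] [FiniteDimensional ℝ E]
  {H : Type*} [TopologicalSpace H] (I : ModelWithCorners ℝ E H)
  (M : Type*) [TopologicalSpace M] [ChartedSpace H M] [IsManifold I ∞ M]
  [RiemannianBundle (fun x : M => TangentSpace I x)]

/-- An almost Hermitian structure on the Riemannian manifold `M`: a smooth almost complex structure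
`J` which is orthogonal with respect to the Riemannian metric. -/
structure AlmostHermitianStructure where
  /-- The almost complex structure, a section of `End (TM)`. -/
  J : Π x : M, TangentSpace I x →L[ℝ] TangentSpace I x
  contMDiff_J : ContMDiff I (I.prod 𝓘(ℝ, E →L[ℝ] E)) ∞
    (fun x : M => TotalSpace.mk' (E →L[ℝ] E)
      (E := fun x : M => TangentSpace I x →L[ℝ] TangentSpace I x) x (J x))
  J_J : ∀ (x : M) (v : TangentSpace I x), J x (J x v) = -v
  inner_J_J : ∀ (x : M) (v w : TangentSpace I x), inner ℝ (J x v) (J x w) = (inner ℝ v w : ℝ)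

variable {I M} [IsContMDiffRiemannianBundle I ∞ E (fun x : M => TangentSpace I x)]

namespace AlmostHermitianStructure
variable (S : AlmostHermitianStructure I M)

lemma mdiff_J {x : M} {W : Π x : M, TangentSpace I x} (hW : MDiffAt (T% W) x) :
    MDiffAt (T% (fun y => S.J y (W y))) x :=
  ((S.contMDiff_J x).mdifferentiableAt (by simp)).clm_bundle_apply hW

lemma tensorialAt_covJ (x : M) :
    TensorialAt I E (fun W : Π x : M, TangentSpace I x =>
      leviCivita I M (fun y => S.J y (W y)) x - (S.J x).comp (leviCivita I M W x)) x where
  smul {f W} hf hW := by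
    have h : (fun y => S.J y ((f • W) y)) = f • fun y => S.J y (W y) := by
      ext1 y; simp
    simp only [h]
    rw [(leviCivita I M).isCovariantDerivativeOnUniv.leibniz hW hf,
     (leviCivita I M).isCovariantDerivativeOnUniv.leibniz (S.mdiff_J hW) hf]
    ext1 v
    simp [smul_sub]
  add {W W'} hW hW' := by
    have h : (fun y => S.J y ((W + W') y)) = (fun y => S.J y (W y)) + fun y => S.J y (W' y) := by
      ext1 y; simp
    simp only [h]
    rw [(leviCivita I M).isCovariantDerivativeOnUniv.add hW hW',
     (leviCivita I M).isCovariantDerivativeOnUniv.add (S.mdiff_J hW) (S.mdiff_J hW')]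
    ext1 v
    simp
    abel

/-- The covariant derivative of `J`: `S.covJ x w v` is `(∇_v J) w = ∇_v (J W) - J (∇_v W)`, where
`W` is any vector field differentiable at `x` with `W x = w`, see `covJ_apply`. -/
noncomputable def covJ (x : M) :
    TangentSpace I x →L[ℝ] TangentSpace I x →L[ℝ] TangentSpace I x :=
  TensorialAt.mkHom (fun W : Π x : M, TangentSpace I x =>
      leviCivita I M (fun y => S.J y (W y)) x - (S.J x).comp (leviCivita I M W x)) x
    (S.tensorialAt_covJ x)

lemma covJ_apply {x : M} {W : Π x : M, TangentSpace I x} (hW : MDiffAt (T% W) x)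
    (v : TangentSpace I x) :
    S.covJ x (W x) v =
      leviCivita I M (fun y => S.J y (W y)) x v - S.J x (leviCivita I M W x v) := by
  rw [covJ, TensorialAt.mkHom_apply (S.tensorialAt_covJ x) hW]
  rfl

/-- Nearly Kähler: `(∇_X J) X = 0` for all tangent vectors `X`. -/
def IsNearlyKahler : Prop := ∀ (x : M) (v : TangentSpace I x), S.covJ x v v = 0

/-- Strict nearly Kähler: moreover `∇_X J ≠ 0` for all tangent vectors `X ≠ 0`. -/
def IsStrictNearlyKahler : Prop :=
  S.IsNearlyKahler ∧ ∀ (x : M) (v : TangentSpace I x), v ≠ 0 → ∃ w, S.covJ x w v ≠ 0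

/-- The canonical connection `∇̄_X Y = ∇_X Y - (1/2) J (∇_X J) Y`. -/
noncomputable def canonicalConnection : CovariantDerivative I E (fun x : M => TangentSpace I x) :=
  (leviCivita I M).addOneForm fun x =>
    -(1 / 2 : ℝ) • (ContinuousLinearMap.postcomp (TangentSpace I x) (S.J x)).comp (S.covJ x)

lemma canonicalConnection_apply (Y : Π x : M, TangentSpace I x) (x : M) (v : TangentSpace I x) :
    S.canonicalConnection Y x v =
      leviCivita I M Y x v - (1 / 2 : ℝ) • S.J x (S.covJ x (Y x) v) := by
  simp [canonicalConnection, CovariantDerivative.addOneForm, sub_eq_add_neg]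

/-- The torsion `T(X, Y)` of the canonical connection. -/
noncomputable def canonicalTorsion (x : M) :
    TangentSpace I x →L[ℝ] TangentSpace I x →L[ℝ] TangentSpace I x :=
  S.canonicalConnection.torsion x

/-- The fundamental two-form `ω(X, Y) = g(JX, Y)`. -/
noncomputable def fundamentalForm (x : M) (v w : TangentSpace I x) : ℝ := inner ℝ (S.J x v) w

end AlmostHermitianStructure

end AlmostHermitian

section Trivialization
variable {E : Type*} [NormedAddCommGroup E] [NormedSpace ℝ E]
  {H : Type*} [TopologicalSpace H] {I : ModelWithCorners ℝ E H}
  {M : Type*} [TopologicalSpace M] [ChartedSpace H M] [IsManifold I ∞ M]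

/-- The components, in the local trivialization of `TM` around `x`, of a tangent vector `v` at
`y`. -/
noncomputable def trivComp (x y : M) (v : TangentSpace I y) : E :=
  (trivializationAt E (fun x : M => TangentSpace I x) x ⟨y, v⟩).2

lemma symmL_trivComp (x : M) (v : TangentSpace I x) :
    (trivializationAt E (fun x : M => TangentSpace I x) x).symmL ℝ x (trivComp x x v) = v := by
  have hx := FiberBundle.mem_baseSet_trivializationAt E (fun x : M => TangentSpace I x) x
  rw [trivComp, Trivialization.symmL_apply _ hx,
    Trivialization.symm_apply_apply_mk _ hx]

lemma trivComp_add {x y : M} (hy : y ∈ (trivializationAt E (fun x : M => TangentSpace I x) x).baseSet)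
    (v w : TangentSpace I y) :
    trivComp x y (v + w) = trivComp x y v + trivComp x y w :=
  ((trivializationAt E (fun x : M => TangentSpace I x) x).linear ℝ hy).map_add v w

lemma trivComp_smul {x y : M} (hy : y ∈ (trivializationAt E (fun x : M => TangentSpace I x) x).baseSet)
    (c : ℝ) (v : TangentSpace I y) :
    trivComp x y (c • v) = c • trivComp x y v :=
  ((trivializationAt E (fun x : M => TangentSpace I x) x).linear ℝ hy).map_smul c v

lemma trivComp_extend {x y : M} (hy : y ∈ (trivializationAt E (fun x : M => TangentSpace I x) x).baseSet)
    (v : TangentSpace I x) :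
    trivComp x y (FiberBundle.extend E v y) = trivComp x x v := by
  rw [trivComp, FiberBundle.extend, (trivializationAt E (fun x : M => TangentSpace I x) x).apply_mk_symm hy]
  rfl

lemma mvfderiv_congr {E' : Type*} [NormedAddCommGroup E'] [NormedSpace ℝ E'] {H' : Type*}
    [TopologicalSpace H'] {I' : ModelWithCorners ℝ E' H'} {N : Type*} [TopologicalSpace N]
    [ChartedSpace H' N] {A : Type*} [NormedAddCommGroup A] [NormedSpace ℝ A] {g h : N → A} {x : N}
    (hgh : g =ᶠ[𝓝 x] h) : mvfderiv I' g x = mvfderiv I' h x := by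
  ext v
  exact congrArg (fun B : TangentSpace I' x →L[ℝ] A => B v) hgh.mfderiv_eq

lemma baseSet_mem_nhds (x : M) :
    (trivializationAt E (fun x : M => TangentSpace I x) x).baseSet ∈ 𝓝 x :=
  (trivializationAt E (fun x : M => TangentSpace I x) x).open_baseSet.mem_nhds
    (FiberBundle.mem_baseSet_trivializationAt E (fun x : M => TangentSpace I x) x)

end Trivialization

section Immersion
variable {E : Type*} [NormedAddCommGroup E] [NormedSpace ℝ E] [FiniteDimensional ℝ E]
  {H : Type*} [TopologicalSpace H] {I : ModelWithCorners ℝ E H}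
  {M : Type*} [TopologicalSpace M] [ChartedSpace H M] [IsManifold I ∞ M]
  [RiemannianBundle (fun x : M => TangentSpace I x)]
  [IsContMDiffRiemannianBundle I ∞ E (fun x : M => TangentSpace I x)]
  {n : ℕ} {L : Type*} [TopologicalSpace L] [ChartedSpace (EuclideanSpace ℝ (Fin n)) L]
  [IsManifold (𝓡 n) ∞ L]

lemma leviCivita_eq_trivialized {x : M} {Y : Π x : M, TangentSpace I x} (hY : MDiffAt (T% Y) x) :
    leviCivita I M Y x =
      ((trivializationAt E (fun x : M => TangentSpace I x) x).symmL ℝ x).comp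
        (mvfderiv I (fun y => trivComp x y (Y y)) x) +
      leviCivita I M (FiberBundle.extend E (Y x)) x := by
  have hb := baseSet_mem_nhds (I := I) x
  have hd : ∀ {W : Π x : M, TangentSpace I x}, MDiffAt (T% W) x →
      MDiffAt (fun y => trivComp x y (W y)) x := fun hW =>
    (mdifferentiableAt_section I _).1 hW
  have ht : TensorialAt I E (fun W : Π x : M, TangentSpace I x => leviCivita I M W x -
      ((trivializationAt E (fun x : M => TangentSpace I x) x).symmL ℝ x).comp
        (mvfderiv I (fun y => trivComp x y (W y)) x)) x := by
    refine ⟨fun {f W} hf hW => ?_, fun {W W'} hW hW' => ?_⟩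
    · have h : mvfderiv I (fun y => trivComp x y ((f • W) y)) x =
        f x • mvfderiv I (fun y => trivComp x y (W y)) x +
          (mvfderiv I f x).smulRight (trivComp x x (W x)) := by
        rw [← mvfderiv_fun_smul hf (hd hW)]
        exact mvfderiv_congr (Filter.eventually_of_mem hb fun y hy => trivComp_smul hy (f y) (W y))
      rw [h, (leviCivita I M).isCovariantDerivativeOnUniv.leibniz hW hf]
      ext1 v
      simp [symmL_trivComp, smul_sub]
    · have h : mvfderiv I (fun y => trivComp x y ((W + W') y)) x =
          mvfderiv I (fun y => trivComp x y (W y)) x +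
            mvfderiv I (fun y => trivComp x y (W' y)) x := by
        rw [← mvfderiv_fun_add (hd hW) (hd hW')]
        exact mvfderiv_congr (Filter.eventually_of_mem hb fun y hy => trivComp_add hy (W y) (W' y))
      rw [h, (leviCivita I M).isCovariantDerivativeOnUniv.add hW hW']
      ext1 v
      simp
      abel
  have h := ht.pointwise hY (FiberBundle.mdifferentiableAt_extend I E (Y x)) (by simp)
  have h0 : mvfderiv I (fun y => trivComp x y (FiberBundle.extend E (Y x) y)) x = 0 := by
    rw [← mvfderiv_const (I := I) (trivComp x x (Y x))]
    exact mvfderiv_congr (Filter.eventually_of_mem hb fun y hy => trivComp_extend hy (Y x))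
  simp only [h0, ContinuousLinearMap.comp_zero, sub_zero] at h
  rw [← h]
  abel

lemma leviCivita_extend_add {x : M} (v w : TangentSpace I x) :
    leviCivita I M (FiberBundle.extend E (v + w)) x =
      leviCivita I M (FiberBundle.extend E v) x + leviCivita I M (FiberBundle.extend E w) x := by
  have h := leviCivita_eq_trivialized (mdifferentiableAt_add_section
    (FiberBundle.mdifferentiableAt_extend I E v) (FiberBundle.mdifferentiableAt_extend I E w))
  have h0 : mvfderiv I (fun y => trivComp x y
      ((FiberBundle.extend E v + FiberBundle.extend E w : Π y : M, TangentSpace I y) y)) x = 0 := by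
    rw [← mvfderiv_const (I := I) (trivComp x x v + trivComp x x w)]
    refine mvfderiv_congr (Filter.eventually_of_mem (baseSet_mem_nhds (I := I) x) fun y hy => ?_)
    beta_reduce
    rw [Pi.add_apply, trivComp_add hy, trivComp_extend hy, trivComp_extend hy]
  rw [h0, (leviCivita I M).isCovariantDerivativeOnUniv.add
    (FiberBundle.mdifferentiableAt_extend I E v) (FiberBundle.mdifferentiableAt_extend I E w)] at h
  simpa using h.symm

lemma leviCivita_extend_smul {x : M} (c : ℝ) (v : TangentSpace I x) :
    leviCivita I M (FiberBundle.extend E (c • v)) x =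
      c • leviCivita I M (FiberBundle.extend E v) x := by
  have h := leviCivita_eq_trivialized ((mdifferentiableAt_const (c := c)).smul_section
    (FiberBundle.mdifferentiableAt_extend I E v))
  have h0 : mvfderiv I (fun y => trivComp x y
      (((fun _ => c : M → ℝ) • FiberBundle.extend E v : Π y : M, TangentSpace I y) y)) x = 0 := by
    rw [← mvfderiv_const (I := I) (c • trivComp x x v)]
    refine mvfderiv_congr (Filter.eventually_of_mem (baseSet_mem_nhds (I := I) x) fun y hy => ?_)
    beta_reduce
    rw [Pi.smul_apply', trivComp_smul hy, trivComp_extend hy]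
  rw [h0, (leviCivita I M).isCovariantDerivativeOnUniv.leibniz
    (FiberBundle.mdifferentiableAt_extend I E v) mdifferentiableAt_const,
    mvfderiv_const] at h
  simpa using h.symm

/-- The covariant derivative `∇_u V` at `p` of a vector field `V` along a map `f : L → M`, that is,
of a section of the pullback bundle `f^* TM` with its pullback connection. In terms of the local
coordinate frame `∂_i` of `TM` around `f p` and `V = V^i ∂_i`, it is
`dV^i(u) ∂_i + V^i ∇_{df(u)} ∂_i`. It satisfies the Leibniz rule `pullbackDeriv_smul`, and
`pullbackDeriv_comp` if `V` comes from a vector field on `M`. -/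
noncomputable def pullbackDeriv (f : L → M) (V : Π p : L, TangentSpace I (f p)) (p : L) :
    TangentSpace (𝓡 n) p →L[ℝ] TangentSpace I (f p) :=
  ((trivializationAt E (fun x : M => TangentSpace I x) (f p)).symmL ℝ (f p)).comp
      (mvfderiv (𝓡 n) (fun q : L => trivComp (f p) (f q) (V q)) p) +
    (leviCivita I M (FiberBundle.extend E (V p)) (f p)).comp (mfderiv (𝓡 n) I f p)

lemma pullbackDeriv_comp {f : L → M} {p : L} (hf : MDifferentiableAt (𝓡 n) I f p)
    {Y : Π x : M, TangentSpace I x} (hY : MDiffAt (T% Y) (f p)) :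
    pullbackDeriv f (fun q => Y (f q)) p =
      (leviCivita I M Y (f p)).comp (mfderiv (𝓡 n) I f p) := by
  rw [leviCivita_eq_trivialized hY]
  have hd : MDiffAt (fun y => trivComp (f p) y (Y y)) (f p) := (mdifferentiableAt_section I _).1 hY
  have h : mvfderiv (𝓡 n) (fun q : L => trivComp (f p) (f q) (Y (f q))) p =
      (mvfderiv I (fun y => trivComp (f p) y (Y y)) (f p)).comp (mfderiv (𝓡 n) I f p) := by
    ext v
    exact mfderiv_comp_apply p hd hf v
  rw [pullbackDeriv, h]
  rfl

variable {f : L → M} {p : L} {V W : Π p : L, TangentSpace I (f p)}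

lemma mdiff_trivComp
    (hV : MDifferentiableAt (𝓡 n) I.tangent (fun q => (⟨f q, V q⟩ : TangentBundle I M)) p) :
    MDifferentiableAt (𝓡 n) 𝓘(ℝ, E) (fun q => trivComp (f p) (f q) (V q)) p :=
  ((mdifferentiableAt_totalSpace I _).1 hV).2

lemma eventually_mem_baseSet (hf : ContinuousAt f p) :
    ∀ᶠ q in 𝓝 p, f q ∈ (trivializationAt E (fun x : M => TangentSpace I x) (f p)).baseSet :=
  hf.eventually_mem (baseSet_mem_nhds (I := I) (f p))

lemma pullbackDeriv_add
    (hV : MDifferentiableAt (𝓡 n) I.tangent (fun q => (⟨f q, V q⟩ : TangentBundle I M)) p)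
    (hW : MDifferentiableAt (𝓡 n) I.tangent (fun q => (⟨f q, W q⟩ : TangentBundle I M)) p) :
    pullbackDeriv (n := n) f (fun q => V q + W q) p = pullbackDeriv f V p + pullbackDeriv f W p := by
  have hf : ContinuousAt f p := ((mdifferentiableAt_totalSpace I _).1 hV).1.continuousAt
  have h : mvfderiv (𝓡 n) (fun q => trivComp (f p) (f q) (V q + W q)) p =
      mvfderiv (𝓡 n) (fun q => trivComp (f p) (f q) (V q)) p +
        mvfderiv (𝓡 n) (fun q => trivComp (f p) (f q) (W q)) p := by
    rw [← mvfderiv_fun_add (mdiff_trivComp hV) (mdiff_trivComp hW)]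
    exact mvfderiv_congr ((eventually_mem_baseSet hf).mono fun q hq => trivComp_add hq _ _)
  rw [pullbackDeriv, h, leviCivita_extend_add, pullbackDeriv, pullbackDeriv]
  ext1 v
  simp
  abel

lemma pullbackDeriv_smul {c : L → ℝ} (hc : MDifferentiableAt (𝓡 n) 𝓘(ℝ, ℝ) c p)
    (hV : MDifferentiableAt (𝓡 n) I.tangent (fun q => (⟨f q, V q⟩ : TangentBundle I M)) p) :
    pullbackDeriv f (fun q => c q • V q) p =
      c p • pullbackDeriv f V p + (mvfderiv (𝓡 n) c p).smulRight (V p) := by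
  have hf : ContinuousAt f p := ((mdifferentiableAt_totalSpace I _).1 hV).1.continuousAt
  have h : mvfderiv (𝓡 n) (fun q => trivComp (f p) (f q) (c q • V q)) p =
      c p • mvfderiv (𝓡 n) (fun q => trivComp (f p) (f q) (V q)) p +
        (mvfderiv (𝓡 n) c p).smulRight (trivComp (f p) (f p) (V p)) := by
    rw [← mvfderiv_fun_smul hc (mdiff_trivComp hV)]
    exact mvfderiv_congr ((eventually_mem_baseSet hf).mono fun q hq => trivComp_smul hq _ _)
  rw [pullbackDeriv, h, leviCivita_extend_smul, pullbackDeriv]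
  ext1 v
  simp [symmL_trivComp]
  abel

variable (I n) in
/-- The tangent space `df(T_p L) ⊆ T_{f p} M` of the immersed submanifold at `p`. -/
noncomputable def tangentPart (f : L → M) (p : L) : Submodule ℝ (TangentSpace I (f p)) :=
  LinearMap.range (mfderiv (𝓡 n) I f p).toLinearMap

/-- The second fundamental form `II(u, v)` at `p` of an immersion `f : L → M`: the component normal
to `df(T_p L)` of `∇_u (df Y)`, where `Y` is any vector field on `L` differentiable at `p` with
`Y p = v`, see `secondFundamentalForm_apply`. -/
noncomputable def secondFundamentalForm (f : L → M) (p : L) (u v : TangentSpace (𝓡 n) p) :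
    TangentSpace I (f p) :=
  (tangentPart I n f p)ᗮ.starProjection
    (pullbackDeriv (I := I) (n := n) f (fun q => mfderiv (𝓡 n) I f q
      (FiberBundle.extend (EuclideanSpace ℝ (Fin n)) v q)) p u)

lemma secondFundamentalForm_apply (hf : ContMDiff (𝓡 n) I ∞ f) {Y : Π p : L, TangentSpace (𝓡 n) p}
    (hY : MDifferentiableAt (𝓡 n) (𝓡 n).tangent (fun q => (⟨q, Y q⟩ : TangentBundle (𝓡 n) L)) p)
    (u : TangentSpace (𝓡 n) p) :
    secondFundamentalForm (I := I) f p u (Y p) = (tangentPart I n f p)ᗮ.starProjection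
      (pullbackDeriv (I := I) f (fun q => mfderiv (𝓡 n) I f q (Y q)) p u) := by
  have hd : ∀ {Z : Π p : L, TangentSpace (𝓡 n) p},
      MDifferentiableAt (𝓡 n) (𝓡 n).tangent (fun q => (⟨q, Z q⟩ : TangentBundle (𝓡 n) L)) p →
      MDifferentiableAt (𝓡 n) I.tangent
        (fun q => (⟨f q, mfderiv (𝓡 n) I f q (Z q)⟩ : TangentBundle I M)) p := fun {Z} hZ =>
    ((hf.contMDiff_tangentMap (m := 1) (by norm_cast)).mdifferentiable (by norm_num) _).comp p hZ
  have ht : TensorialAt (𝓡 n) (EuclideanSpace ℝ (Fin n)) (fun Z : Π p : L, TangentSpace (𝓡 n) p =>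
      (tangentPart I n f p)ᗮ.starProjection
        (pullbackDeriv (I := I) f (fun q => mfderiv (𝓡 n) I f q (Z q)) p u)) p := by
    refine ⟨fun {c Z} hc hZ => ?_, fun {Z Z'} hZ hZ' => ?_⟩
    · have h : (fun q => mfderiv (𝓡 n) I f q ((c • Z) q)) =
          fun q => c q • mfderiv (𝓡 n) I f q (Z q) := by ext1 q; simp
      have hn : (tangentPart I n f p)ᗮ.starProjection (mfderiv (𝓡 n) I f p (Z p)) = 0 := by
        rw [Submodule.starProjection_apply, Submodule.orthogonalProjectionOnto_orthogonal_apply_eq_zero]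
        · rfl
        · exact ⟨Z p, rfl⟩
      rw [h, pullbackDeriv_smul hc (hd hZ), add_apply, map_add, smul_apply,
        ContinuousLinearMap.smulRight_apply, map_smul, map_smul, hn, smul_zero, add_zero]
    · have h : (fun q => mfderiv (𝓡 n) I f q ((Z + Z') q)) =
          fun q => mfderiv (𝓡 n) I f q (Z q) + mfderiv (𝓡 n) I f q (Z' q) := by ext1 q; simp
      rw [h, pullbackDeriv_add (hd hZ) (hd hZ'), add_apply, map_add]
  exact ht.pointwise (FiberBundle.mdifferentiableAt_extend ..) hY (by simp)

/-- `e_1, …, e_n` is an orthonormal basis of `T_p L` for the metric induced by `f`. -/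
def IsOrthonormalFrame (f : L → M) (p : L) (e : Fin n → TangentSpace (𝓡 n) p) : Prop :=
  Orthonormal ℝ fun i => (mfderiv (𝓡 n) I f p (e i) : TangentSpace I (f p))

lemma exists_isOrthonormalFrame {f : L → M} {p : L}
    (hf : Function.Injective (mfderiv (𝓡 n) I f p)) :
    ∃ e : Fin n → TangentSpace (𝓡 n) p, IsOrthonormalFrame (I := I) f p e := by
  have hn : Module.finrank ℝ (tangentPart I n f p) = n := by
    rw [tangentPart, LinearMap.finrank_range_of_inj hf]
    exact finrank_euclideanSpace_fin
  let b := (stdOrthonormalBasis ℝ (tangentPart I n f p)).reindex (finCongr hn)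
  choose e he using fun i => (b i).2
  refine ⟨e, ?_⟩
  have h : (fun i => (mfderiv (𝓡 n) I f p (e i) : TangentSpace I (f p))) =
      fun i => ((b i : tangentPart I n f p) : TangentSpace I (f p)) := funext he
  rw [IsOrthonormalFrame, h]
  exact b.orthonormal.comp_linearIsometry (tangentPart I n f p).subtypeₗᵢ

/-- The mean curvature vector `H = ∑ II(e_i, e_i)`, where `e` is an orthonormal basis of `T_p L`. -/
noncomputable def meanCurvature (f : L → M) (p : L) (e : Fin n → TangentSpace (𝓡 n) p) :
    TangentSpace I (f p) :=
  ∑ i, secondFundamentalForm (I := I) f p (e i) (e i)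

variable (I n) in
/-- Minimality: the mean curvature vector vanishes identically. -/
def IsMinimal (f : L → M) : Prop :=
  ∀ (p : L) (e : Fin n → TangentSpace (𝓡 n) p),
    IsOrthonormalFrame (I := I) f p e → meanCurvature (I := I) f p e = 0

variable (n L) in
/-- A smooth `n`-manifold is orientable if its tangent spaces can be oriented in such a way that
around every point there is a positively oriented smooth local frame. -/
def IsOrientable : Prop :=
  ∃ o : Π p : L, Orientation ℝ (TangentSpace (𝓡 n) p) (Fin n),
    ∀ p : L, ∃ u : Set L, IsOpen u ∧ p ∈ u ∧
      ∃ (s : Fin n → Π q : L, TangentSpace (𝓡 n) q)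
        (hs : IsLocalFrameOn (𝓡 n) (EuclideanSpace ℝ (Fin n)) ∞ s u),
        ∀ q (hq : q ∈ u), (hs.toBasisAt hq).orientation = o q

namespace AlmostHermitianStructure
variable (S : AlmostHermitianStructure I M)

variable (n) in
/-- A Lagrangian immersion: a smooth immersion `f : L → M` with `f^* ω = 0` and
`dim M = 2 dim L`. -/
structure IsLagrangianImmersion (f : L → M) : Prop where
  contMDiff : ContMDiff (𝓡 n) I ∞ f
  injective_mfderiv : ∀ p : L, Function.Injective (mfderiv (𝓡 n) I f p)
  finrank_eq : Module.finrank ℝ E = 2 * n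
  fundamentalForm_eq_zero : ∀ (p : L) (u v : TangentSpace (𝓡 n) p),
    S.fundamentalForm (f p) (mfderiv (𝓡 n) I f p u) (mfderiv (𝓡 n) I f p v) = 0

/-- The tensor `C(X, Y, Z) = ⟨II(X, Y), J Z⟩` for `X, Y` tangent to `L` and `Z` a tangent vector of
`M` at `f p`. -/
noncomputable def cTensor (f : L → M) (p : L) (u v : TangentSpace (𝓡 n) p)
    (Z : TangentSpace I (f p)) : ℝ :=
  inner ℝ (secondFundamentalForm (I := I) f p u v) (S.J (f p) Z)

/-- The trace `α(X, Y) = ∑ C(e_i, X, T(e_i, Y))`, where `e` is an orthonormal basis of `T_p L`. -/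
noncomputable def alphaTensor (f : L → M) (p : L) (e : Fin n → TangentSpace (𝓡 n) p)
    (u v : TangentSpace (𝓡 n) p) : ℝ :=
  ∑ i, S.cTensor f p (e i) u
    (S.canonicalTorsion (f p) (mfderiv (𝓡 n) I f p (e i)) (mfderiv (𝓡 n) I f p v))

end AlmostHermitianStructure

end Immersion

end NearlyKahler

namespace NearlyKahler

section Fields

variable {E : Type*} [NormedAddCommGroup E] [NormedSpace ℝ E] [FiniteDimensional ℝ E]
  {H : Type*} [TopologicalSpace H] {I : ModelWithCorners ℝ E H}
  {M : Type*} [TopologicalSpace M] [ChartedSpace H M] [IsManifold I ∞ M]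
  {x : M} {W X Y Z : Π x : M, TangentSpace I x} {φ : M → ℝ}

variable (I) in
/-- The vector field `X` is smooth near `x`. -/
def SmoothAt (X : Π x : M, TangentSpace I x) (x : M) : Prop :=
  CMDiffAt ∞ (T% X) x

lemma SmoothAt.mdiffAt (hX : SmoothAt I X x) : MDiffAt (T% X) x :=
  ContMDiffAt.mdifferentiableAt hX (by simp)

lemma eventually_mdiffAt_of_contMDiffAt {E' : Type*} [NormedAddCommGroup E'] [NormedSpace ℝ E']
    {H' : Type*} [TopologicalSpace H'] {I' : ModelWithCorners ℝ E' H'} {N : Type*}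
    [TopologicalSpace N] [ChartedSpace H' N] [IsManifold I' ∞ N] {g : M → N}
    (hg : CMDiffAt ∞ g x) : ∀ᶠ y in 𝓝 x, MDiffAt g y := by
  have h : CMDiffAt 1 g x := hg.of_le (by norm_cast)
  have : IsManifold I 1 M := .of_le (n := ∞) (by norm_cast)
  have : IsManifold I' 1 N := .of_le (n := ∞) (by norm_cast)
  exact ((contMDiffAt_iff_contMDiffAt_nhds (by simp)).1 h).mono fun y hy =>
    hy.mdifferentiableAt (by simp)

lemma SmoothAt.eventually_mdiffAt (hX : SmoothAt I X x) : ∀ᶠ y in 𝓝 x, MDiffAt (T% X) y :=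
  eventually_mdiffAt_of_contMDiffAt hX

lemma smoothAt_extend (v : TangentSpace I x) : SmoothAt I (FiberBundle.extend E v) x := by
  rw [SmoothAt, contMDiffAt_section]
  refine (contMDiffAt_const (c := trivComp x x v)).congr_of_eventuallyEq ?_
  exact Filter.eventually_of_mem (baseSet_mem_nhds (I := I) x) fun y hy => trivComp_extend hy v

lemma SmoothAt.mlieBracket (hX : SmoothAt I X x) (hY : SmoothAt I Y x) :
    SmoothAt I (mlieBracket I X Y) x := by
  have : IsManifold I (minSmoothness ℝ 2) M := by
    rw [minSmoothness_of_isRCLikeNormedField]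
    exact .of_le (n := ∞) (by norm_cast)
  have : IsManifold I (((⊤ : ℕ∞) : WithTop ℕ∞) + 1) M := inferInstanceAs (IsManifold I ∞ M)
  exact ContMDiffAt.mlieBracket_vectorField (n := ⊤) (m := ⊤) hX hY (by simp)

lemma SmoothAt.smul (hφ : CMDiffAt ∞ φ x) (hY : SmoothAt I Y x) : SmoothAt I (φ • Y) x :=
  ContMDiffAt.smul_section hφ hY

lemma SmoothAt.mvfderiv {F : Type*} [NormedAddCommGroup F] [NormedSpace ℝ F] {g : M → F}
    (hX : SmoothAt I X x) (hg : CMDiffAt ∞ g x) :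
    CMDiffAt ∞ (fun y => mvfderiv I g y (X y)) x := by
  have h := ContMDiffAt.mfderiv_const (m := ∞) hg (by simp)
  exact (contMDiff_snd_tangentBundle_modelSpace F 𝓘(ℝ, F) (n := ∞)).contMDiffAt.comp x
    (ContMDiffAt.clm_apply_of_inCoordinates h hX hg)

lemma mvfderiv_clm_comp {F : Type*} [NormedAddCommGroup F] [NormedSpace ℝ F] (l : F →L[ℝ] ℝ) {g : M → F} (hg : MDiffAt g x)
    (v : TangentSpace I x) :
    mvfderiv I (fun y => l (g y)) x v = l (mvfderiv I g x v) := by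
  have h := mvfderiv_comp_apply (f := g) x (l.mdifferentiableAt (x := g x)) hg v
  have e : mvfderiv 𝓘(ℝ, F) l (g x) = l := by
    rw [mvfderiv, mfderiv_eq_fderiv, ContinuousLinearMap.fderiv]
    rfl
  rw [e] at h
  exact h

lemma mlieBracket_mlieBracket_smul (hY : SmoothAt I Y x)
    (hZ : SmoothAt I Z x) (hφ : CMDiffAt ∞ φ x) :
    mlieBracket I X (mlieBracket I Y (φ • Z)) x =
      mvfderiv I (fun y => mvfderiv I φ y (Y y)) x (X x) • Z x
        + mvfderiv I φ x (Y x) • mlieBracket I X Z x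
        + mvfderiv I φ x (X x) • mlieBracket I Y Z x
        + φ x • mlieBracket I X (mlieBracket I Y Z) x := by
  have h : mlieBracket I Y (φ • Z) =ᶠ[𝓝 x]
      (fun y => mvfderiv I φ y (Y y)) • Z + φ • mlieBracket I Y Z := by
    filter_upwards [hZ.eventually_mdiffAt, eventually_mdiffAt_of_contMDiffAt hφ] with y hy hφy
    rw [mlieBracket_smul_right hφy hy]
    rfl
  have h1 : CMDiffAt ∞ (fun y => mvfderiv I φ y (Y y)) x := hY.mvfderiv hφ
  rw [(Filter.EventuallyEq.refl _ X).mlieBracket_vectorField_eq h,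
    mlieBracket_add_right (SmoothAt.smul h1 hZ).mdiffAt
      (SmoothAt.smul hφ (hY.mlieBracket hZ)).mdiffAt,
    mlieBracket_smul_right (h1.mdifferentiableAt (by simp)) hZ.mdiffAt,
    mlieBracket_smul_right (hφ.mdifferentiableAt (by simp)) (hY.mlieBracket hZ).mdiffAt]
  abel

/-- Differentiation along a Lie bracket is the commutator of differentiations. -/
theorem mvfderiv_mlieBracket (hX : SmoothAt I X x) (hY : SmoothAt I Y x) (hφ : CMDiffAt ∞ φ x) :
    mvfderiv I φ x (mlieBracket I X Y x) =
      mvfderiv I (fun y => mvfderiv I φ y (Y y)) x (X x) -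
        mvfderiv I (fun y => mvfderiv I φ y (X y)) x (Y x) := by
  by_cases hv : ∃ v : TangentSpace I x, v ≠ 0
  · obtain ⟨v, hv⟩ := hv
    have hZ := smoothAt_extend v
    have : IsManifold I (minSmoothness ℝ 3) M := by
      rw [minSmoothness_of_isRCLikeNormedField]
      exact .of_le (n := ∞) (by norm_cast)
    have hs : ∀ {V : Π x : M, TangentSpace I x}, SmoothAt I V x →
        CMDiffAt (minSmoothness ℝ 2) (T% V) x := fun h => by
      rw [minSmoothness_of_isRCLikeNormedField]
      exact ContMDiffAt.of_le h (by norm_cast)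
    have h1 := leibniz_identity_mlieBracket_apply (hs hX) (hs hY) (hs hZ)
    have h2 := leibniz_identity_mlieBracket_apply (hs hX) (hs hY) (hs (SmoothAt.smul hφ hZ))
    rw [mlieBracket_mlieBracket_smul hY hZ hφ, mlieBracket_mlieBracket_smul hX hZ hφ,
      mlieBracket_smul_right (hφ.mdifferentiableAt (by simp)) hZ.mdiffAt, h1,
      FiberBundle.extend_apply_self] at h2
    have h3 : (mvfderiv I φ x (mlieBracket I X Y x) -
      (mvfderiv I (fun y => mvfderiv I φ y (Y y)) x (X x) -
        mvfderiv I (fun y => mvfderiv I φ y (X y)) x (Y x))) • v = 0 := by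
      rw [smul_add] at h2
      rw [sub_smul, sub_smul, ← sub_eq_zero.2 h2.symm]
      abel
    exact sub_eq_zero.1 ((smul_eq_zero.1 h3).resolve_right hv)
  · push Not at hv
    rw [hv (X x), hv (Y x), hv (mlieBracket I X Y x)]
    simp

/-- The version of `mvfderiv_mlieBracket` for vector-valued functions. -/
theorem mvfderiv_mlieBracket_vector {F : Type*} [NormedAddCommGroup F] [NormedSpace ℝ F]
    [FiniteDimensional ℝ F] {g : M → F} (hX : SmoothAt I X x) (hY : SmoothAt I Y x)
    (hg : CMDiffAt ∞ g x) :
    mvfderiv I g x (mlieBracket I X Y x) =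
      mvfderiv I (fun y => mvfderiv I g y (Y y)) x (X x) -
        mvfderiv I (fun y => mvfderiv I g y (X y)) x (Y x) := by
  refine (Module.finBasis ℝ F).ext_elem fun k => ?_
  let l : F →L[ℝ] ℝ := ((Module.finBasis ℝ F).coord k).toContinuousLinearMap
  change l _ = l _
  have hl : CMDiffAt ∞ (fun y => l (g y)) x := l.contMDiff.contMDiffAt.comp x hg
  have h : ∀ {U V : Π x : M, TangentSpace I x}, SmoothAt I U x →
      mvfderiv I (fun y => mvfderiv I (fun y => l (g y)) y (U y)) x (V x) =
        l (mvfderiv I (fun y => mvfderiv I g y (U y)) x (V x)) := fun hU => by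
    rw [← mvfderiv_clm_comp l ((hU.mvfderiv hg).mdifferentiableAt (by simp))]
    congr 1
    refine mvfderiv_congr ((eventually_mdiffAt_of_contMDiffAt hg).mono fun y hy => ?_)
    exact mvfderiv_clm_comp l hy _
  rw [map_sub, ← h hX, ← h hY, ← mvfderiv_clm_comp l (hg.mdifferentiableAt (by simp)),
    mvfderiv_mlieBracket hX hY hl]

end Fields
end NearlyKahler

namespace NearlyKahler

section Curvature

variable {E : Type*} [NormedAddCommGroup E] [NormedSpace ℝ E] [FiniteDimensional ℝ E]
  {H : Type*} [TopologicalSpace H] {I : ModelWithCorners ℝ E H}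
  {M : Type*} [TopologicalSpace M] [ChartedSpace H M] [IsManifold I ∞ M]
  [RiemannianBundle (fun x : M => TangentSpace I x)]
  [IsContMDiffRiemannianBundle I ∞ E (fun x : M => TangentSpace I x)]
  {x : M} {W X Y Z : Π x : M, TangentSpace I x}

lemma SmoothAt.inner (hX : SmoothAt I X x) (hY : SmoothAt I Y x) :
    CMDiffAt ∞ (fun y => (inner ℝ (X y) (Y y) : ℝ)) x :=
  ContMDiffAt.inner_bundle hX hY

/-- The function `⟨∇_X Y, Z⟩`. -/
noncomputable def innerCov (X Y Z : Π x : M, TangentSpace I x) (y : M) : ℝ :=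
  inner ℝ (leviCivita I M Y y (X y)) (Z y)

lemma contMDiffAt_innerCov (hX : SmoothAt I X x) (hY : SmoothAt I Y x) (hZ : SmoothAt I Z x) :
    CMDiffAt ∞ (innerCov X Y Z) x := by
  have h : innerCov X Y Z =ᶠ[𝓝 x] fun y => (1 / 2 : ℝ) * koszul Y X Z y := by
    filter_upwards [hX.eventually_mdiffAt, hY.eventually_mdiffAt, hZ.eventually_mdiffAt]
      with y h1 h2 h3
    rw [← inner_leviCivitaFun h1 h2 h3]
    simp [innerCov, leviCivita]
  refine ContMDiffAt.congr_of_eventuallyEq (contMDiffAt_const.mul ?_) h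
  exact (((((hX.mvfderiv (hY.inner hZ)).add (hY.mvfderiv (hZ.inner hX))).sub
    (hZ.mvfderiv (hX.inner hY))).add ((hX.mlieBracket hY).inner hZ)).sub
    ((hY.mlieBracket hZ).inner hX)).add ((hZ.mlieBracket hX).inner hY)

lemma SmoothAt.mdiffAt_innerCov (hX : SmoothAt I X x) (hY : SmoothAt I Y x)
    (hZ : SmoothAt I Z x) : MDiffAt (innerCov X Y Z) x :=
  (contMDiffAt_innerCov hX hY hZ).mdifferentiableAt (by simp)

lemma innerCov_add_swap (hX : MDiffAt (T% X) x) (hY : MDiffAt (T% Y) x) (hZ : MDiffAt (T% Z) x) :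
    innerCov X Y Z x + innerCov X Z Y x = mvfderiv I (fun y => inner ℝ (Y y) (Z y)) x (X x) := by
  rw [leviCivita_metric hX hY hZ, real_inner_comm _ (Y x)]
  rfl

lemma leviCivita_sub_swap (hX : MDiffAt (T% X) x) (hY : MDiffAt (T% Y) x) :
    leviCivita I M Y x (X x) - leviCivita I M X x (Y x) = mlieBracket I X Y x :=
  ((leviCivita I M).torsion_eq_zero_iff.1 leviCivita_torsion) hX hY

/-- The Riemann curvature `⟨R(W, X) Y, Z⟩` of smooth vector fields. -/
noncomputable def riem (W X Y Z : Π x : M, TangentSpace I x) (x : M) : ℝ :=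
  mvfderiv I (innerCov X Y Z) x (W x)
    - inner ℝ (leviCivita I M Y x (X x)) (leviCivita I M Z x (W x))
    - mvfderiv I (innerCov W Y Z) x (X x)
    + inner ℝ (leviCivita I M Y x (W x)) (leviCivita I M Z x (X x))
    - innerCov (mlieBracket I W X) Y Z x

lemma riem_swap₁₂ (W X Y Z : Π x : M, TangentSpace I x) : riem W X Y Z x = -riem X W Y Z x := by
  have h : innerCov (mlieBracket I W X) Y Z x = -innerCov (mlieBracket I X W) Y Z x := by
    rw [innerCov, innerCov, mlieBracket_swap_apply, map_neg, inner_neg_left]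
  rw [riem, riem, h]
  ring

lemma riem_swap₃₄ (hW : SmoothAt I W x) (hX : SmoothAt I X x) (hY : SmoothAt I Y x)
    (hZ : SmoothAt I Z x) : riem W X Y Z x = -riem W X Z Y x := by
  have h : ∀ {U V : Π x : M, TangentSpace I x}, SmoothAt I U x → SmoothAt I V x →
      mvfderiv I (innerCov V Y Z) x (U x) + mvfderiv I (innerCov V Z Y) x (U x) =
      mvfderiv I (fun y => mvfderiv I (fun y => inner ℝ (Y y) (Z y)) y (V y)) x (U x) := by
    intro U V _ hV
    rw [← add_apply, ← mvfderiv_fun_add (hV.mdiffAt_innerCov hY hZ) (hV.mdiffAt_innerCov hZ hY)]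
    congr 1
    refine mvfderiv_congr ?_
    filter_upwards [hV.eventually_mdiffAt, hY.eventually_mdiffAt, hZ.eventually_mdiffAt]
      with y h1 h2 h3
    exact innerCov_add_swap h1 h2 h3
  have h1 := h hW hX
  have h2 := h hX hW
  have h3 := innerCov_add_swap (hW.mlieBracket hX).mdiffAt hY.mdiffAt hZ.mdiffAt
  rw [mvfderiv_mlieBracket hW hX (hY.inner hZ)] at h3
  have e1 := real_inner_comm (leviCivita I M Y x (X x)) (leviCivita I M Z x (W x))
  have e2 := real_inner_comm (leviCivita I M Y x (W x)) (leviCivita I M Z x (X x))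
  rw [riem, riem]
  linarith

lemma mvfderiv_innerCov_sub (hX : SmoothAt I X x) (hY : SmoothAt I Y x) (hZ : SmoothAt I Z x)
    (hW : SmoothAt I W x) :
    mvfderiv I (innerCov X Y Z) x (W x) - mvfderiv I (innerCov Y X Z) x (W x) =
      inner ℝ (leviCivita I M (mlieBracket I X Y) x (W x)) (Z x) +
        inner ℝ (mlieBracket I X Y x) (leviCivita I M Z x (W x)) := by
  rw [← leviCivita_metric hW.mdiffAt (hX.mlieBracket hY).mdiffAt hZ.mdiffAt, ← sub_apply,
    ← mvfderiv_fun_sub (hX.mdiffAt_innerCov hY hZ) (hY.mdiffAt_innerCov hX hZ)]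
  congr 1
  refine mvfderiv_congr ?_
  filter_upwards [hX.eventually_mdiffAt, hY.eventually_mdiffAt] with y h1 h2
  rw [← leviCivita_sub_swap h1 h2, inner_sub_left]
  rfl

/-- The first Bianchi identity. -/
lemma riem_bianchi (hW : SmoothAt I W x) (hX : SmoothAt I X x) (hY : SmoothAt I Y x)
    (hZ : SmoothAt I Z x) : riem W X Y Z x + riem X Y W Z x + riem Y W X Z x = 0 := by
  have h1 := mvfderiv_innerCov_sub hX hY hZ hW
  have h2 := mvfderiv_innerCov_sub hY hW hZ hX
  have h3 := mvfderiv_innerCov_sub hW hX hZ hY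
  rw [← leviCivita_sub_swap hX.mdiffAt hY.mdiffAt, inner_sub_left] at h1
  rw [← leviCivita_sub_swap hY.mdiffAt hW.mdiffAt, inner_sub_left] at h2
  rw [← leviCivita_sub_swap hW.mdiffAt hX.mdiffAt, inner_sub_left] at h3
  have k1 := leviCivita_sub_swap hW.mdiffAt (hX.mlieBracket hY).mdiffAt
  have k2 := leviCivita_sub_swap hX.mdiffAt (hY.mlieBracket hW).mdiffAt
  have k3 := leviCivita_sub_swap hY.mdiffAt (hW.mlieBracket hX).mdiffAt
  have : IsManifold I (minSmoothness ℝ 3) M := by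
    rw [minSmoothness_of_isRCLikeNormedField]
    exact .of_le (n := ∞) (by norm_cast)
  have hs : ∀ {V : Π x : M, TangentSpace I x}, SmoothAt I V x →
      CMDiffAt (minSmoothness ℝ 2) (T% V) x := fun h => by
    rw [minSmoothness_of_isRCLikeNormedField]
    exact ContMDiffAt.of_le h (by norm_cast)
  have hj := leibniz_identity_mlieBracket_apply (hs hW) (hs hX) (hs hY)
  have hj' : mlieBracket I W (mlieBracket I X Y) x + mlieBracket I X (mlieBracket I Y W) x +
      mlieBracket I Y (mlieBracket I W X) x = 0 := by
    have e : mlieBracket I X (mlieBracket I W Y) x = -mlieBracket I X (mlieBracket I Y W) x := by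
      rw [mlieBracket_swap (V := W), ← neg_one_smul ℝ (mlieBracket I Y W),
        mlieBracket_const_smul_right (hY.mlieBracket hW).mdiffAt, neg_one_smul]
    rw [hj, mlieBracket_swap_apply (V := mlieBracket I W X), e]
    abel
  rw [← k1, ← k2, ← k3] at hj'
  have hin := congrArg (fun v => (inner ℝ v (Z x) : ℝ)) hj'
  simp only [inner_add_left, inner_sub_left, inner_zero_left] at hin
  simp only [riem, innerCov] at *
  linarith

lemma riem_pair_symm (hW : SmoothAt I W x) (hX : SmoothAt I X x) (hY : SmoothAt I Y x)
    (hZ : SmoothAt I Z x) : riem W X Y Z x = riem Y Z W X x := by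
  have b1 := riem_bianchi hW hX hY hZ
  have b2 := riem_bianchi hX hY hZ hW
  have b3 := riem_bianchi hY hZ hW hX
  have b4 := riem_bianchi hZ hW hX hY
  have s := fun {A B C D : Π x : M, TangentSpace I x} (hA : SmoothAt I A x) (hB : SmoothAt I B x)
    (hC : SmoothAt I C x) (hD : SmoothAt I D x) => riem_swap₃₄ hA hB hC hD
  linarith [s hX hY hW hZ, s hY hW hX hZ, s hW hX hY hZ, s hY hZ hX hW, s hZ hX hY hW,
    s hZ hW hX hY, s hX hZ hY hW, s hW hY hX hZ, riem_swap₁₂ (x := x) Y W X Z,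
    riem_swap₁₂ (x := x) Z X Y W, riem_swap₁₂ (x := x) W X Z Y, riem_swap₁₂ (x := x) X Z W Y,
    riem_swap₁₂ (x := x) W Y Z X, riem_swap₁₂ (x := x) W Y X Z, riem_swap₁₂ (x := x) X Z Y W,
    s hZ hX hW hY, s hW hY hZ hX, s hX hY hZ hW, s hY hZ hW hX]

lemma leviCivita_neg (hY : MDiffAt (T% Y) x) :
    leviCivita I M (-Y) x = -leviCivita I M Y x := by
  have h := (leviCivita I M).isCovariantDerivativeOnUniv.leibniz hY
    (mdifferentiableAt_const (c := (-1 : ℝ)) (I := I))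
  have e : ((fun _ => -1 : M → ℝ) • Y) = -Y := by
    ext1 y
    simp
  rw [e, mvfderiv_const] at h
  rw [h]
  ext1 v
  simp

lemma innerCov_neg (X Z : Π x : M, TangentSpace I x) (hY : SmoothAt I Y x) :
    innerCov X (-Y) Z =ᶠ[𝓝 x] -innerCov X Y Z := by
  filter_upwards [hY.eventually_mdiffAt] with y hy
  simp [innerCov, leviCivita_neg hy]

lemma riem_neg₃ (W X Z : Π x : M, TangentSpace I x) (hY : SmoothAt I Y x) :
    riem W X (-Y) Z x = -riem W X Y Z x := by
  rw [riem, riem, mvfderiv_congr (innerCov_neg X Z hY), mvfderiv_congr (innerCov_neg W Z hY),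
    (innerCov_neg _ Z hY).self_of_nhds, leviCivita_neg hY.mdiffAt, mvfderiv_neg, mvfderiv_neg]
  simp only [neg_apply, inner_neg_left, Pi.neg_apply]
  ring

end Curvature
end NearlyKahler

namespace NearlyKahler

section CovJ

variable {E : Type*} [NormedAddCommGroup E] [NormedSpace ℝ E] [FiniteDimensional ℝ E]
  {H : Type*} [TopologicalSpace H] {I : ModelWithCorners ℝ E H}
  {M : Type*} [TopologicalSpace M] [ChartedSpace H M] [IsManifold I ∞ M]
  [RiemannianBundle (fun x : M => TangentSpace I x)]
  [IsContMDiffRiemannianBundle I ∞ E (fun x : M => TangentSpace I x)]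
  {x : M} {W X Y Z : Π x : M, TangentSpace I x}

namespace AlmostHermitianStructure
variable (S : AlmostHermitianStructure I M)

/-- The vector field `J X`. -/
noncomputable def JField (X : Π x : M, TangentSpace I x) (x : M) : TangentSpace I x :=
  S.J x (X x)

lemma smoothAt_JField (hX : SmoothAt I X x) : SmoothAt I (S.JField X) x :=
  (S.contMDiff_J x).clm_bundle_apply hX

lemma JField_JField (X : Π x : M, TangentSpace I x) : S.JField (S.JField X) = -X :=
  funext fun y => S.J_J y (X y)

lemma inner_J_left (x : M) (v w : TangentSpace I x) :
    (inner ℝ (S.J x v) w : ℝ) = -inner ℝ v (S.J x w) := by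
  rw [← S.inner_J_J x v, S.J_J, inner_neg_right, neg_neg]

lemma leviCivita_JField (hY : MDiffAt (T% Y) x) (v : TangentSpace I x) :
    leviCivita I M (S.JField Y) x v = S.covJ x (Y x) v + S.J x (leviCivita I M Y x v) := by
  rw [S.covJ_apply hY, sub_add_cancel]
  rfl

lemma covJ_J (x : M) (v w : TangentSpace I x) : S.covJ x (S.J x v) w = -S.J x (S.covJ x v w) := by
  have hV := smoothAt_extend v
  have h := S.leviCivita_JField (S.smoothAt_JField hV).mdiffAt w
  rw [S.JField_JField, leviCivita_neg hV.mdiffAt, S.leviCivita_JField hV.mdiffAt, map_add,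
    S.J_J, neg_apply] at h
  rw [JField, FiberBundle.extend_apply_self] at h
  rw [← add_right_cancel_iff (a := -leviCivita I M (FiberBundle.extend E v) x w),
    eq_comm, ← add_right_cancel_iff (a := S.J x (S.covJ x v w)), add_assoc (S.covJ x _ w),
    add_comm (-leviCivita I M (FiberBundle.extend E v) x w), ← h]
  abel

lemma inner_covJ_left (x : M) (u v w : TangentSpace I x) :
    (inner ℝ (S.covJ x v u) w : ℝ) = -inner ℝ v (S.covJ x w u) := by
  have hU := (smoothAt_extend u).mdiffAt
  have hV := (smoothAt_extend v).mdiffAt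
  have hW := (smoothAt_extend w).mdiffAt
  have h1 := leviCivita_metric hU (S.mdiff_J hV) hW
  have h2 := leviCivita_metric hU hV (S.mdiff_J hW)
  have e : (fun y => (inner ℝ (S.J y (FiberBundle.extend E v y)) (FiberBundle.extend E w y) : ℝ)) =
      -fun y => inner ℝ (FiberBundle.extend E v y) (S.J y (FiberBundle.extend E w y)) :=
    funext fun y => S.inner_J_left y _ _
  have k1 := S.leviCivita_JField hV u
  have k2 := S.leviCivita_JField hW u
  simp only [FiberBundle.extend_apply_self] at k1 k2 h1 h2
  change leviCivita I M (fun y => S.J y _) x u = _ at k1 k2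
  rw [e, mvfderiv_neg, neg_apply, k1, inner_add_left, S.inner_J_left, S.inner_J_left] at h1
  rw [k2, inner_add_right] at h2
  linarith

/-- The tensor `ψ(u, v, w) = ⟨(∇_u J) v, w⟩`. -/
noncomputable def psi (x : M) (u v w : TangentSpace I x) : ℝ := inner ℝ (S.covJ x v u) w

section Psi
variable (u v w z : TangentSpace I x) (c : ℝ)

lemma psi_add₁ : S.psi x (u + z) v w = S.psi x u v w + S.psi x z v w := by
  simp [psi, inner_add_left]
lemma psi_add₂ : S.psi x u (v + z) w = S.psi x u v w + S.psi x u z w := by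
  simp [psi, inner_add_left]
lemma psi_add₃ : S.psi x u v (w + z) = S.psi x u v w + S.psi x u v z := by
  simp [psi, inner_add_right]
lemma psi_smul₁ : S.psi x (c • u) v w = c * S.psi x u v w := by
  simp [psi, inner_smul_left]
lemma psi_smul₂ : S.psi x u (c • v) w = c * S.psi x u v w := by
  simp [psi, inner_smul_left]
lemma psi_smul₃ : S.psi x u v (c • w) = c * S.psi x u v w := by
  simp [psi, inner_smul_right]
lemma psi_neg₃ : S.psi x u v (-w) = -S.psi x u v w := by
  simp [psi]
lemma psi_sub₁ : S.psi x (u - z) v w = S.psi x u v w - S.psi x z v w := by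
  simp [psi, inner_sub_left]

lemma psi_swap₂₃ : S.psi x u v w = -S.psi x u w v := by
  rw [psi, psi, inner_covJ_left, real_inner_comm]

lemma psi_J₂ : S.psi x u (S.J x v) w = S.psi x u v (S.J x w) := by
  rw [psi, psi, covJ_J, inner_neg_left, inner_J_left, neg_neg]

end Psi

section NearlyKahler
variable {S}

lemma IsNearlyKahler.covJ_swap (hS : S.IsNearlyKahler) (u v : TangentSpace I x) :
    S.covJ x v u = -S.covJ x u v := by
  have h := hS x (u + v)
  simp only [map_add, add_apply, hS x u, hS x v] at h
  rw [eq_neg_iff_add_eq_zero, ← h]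
  abel

lemma IsNearlyKahler.covJ_J_right (hS : S.IsNearlyKahler) (u v : TangentSpace I x) :
    S.covJ x v (S.J x u) = -S.J x (S.covJ x v u) := by
  rw [hS.covJ_swap, covJ_J, hS.covJ_swap u v, map_neg]

lemma IsNearlyKahler.psi_swap₁₂ (hS : S.IsNearlyKahler) (u v w : TangentSpace I x) :
    S.psi x u v w = -S.psi x v u w := by
  rw [psi, psi, hS.covJ_swap u v, inner_neg_left]

lemma IsNearlyKahler.psi_J₁ (hS : S.IsNearlyKahler) (u v w : TangentSpace I x) :
    S.psi x (S.J x u) v w = S.psi x u v (S.J x w) := by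
  rw [hS.psi_swap₁₂, psi_J₂, hS.psi_swap₁₂, neg_neg]

lemma IsNearlyKahler.psi_self₁₂ (hS : S.IsNearlyKahler) (u w : TangentSpace I x) :
    S.psi x u u w = 0 := by
  rw [psi, hS, inner_zero_left]

end NearlyKahler
end AlmostHermitianStructure
end CovJ
end NearlyKahler

namespace NearlyKahler

section CovPsi

variable {E : Type*} [NormedAddCommGroup E] [NormedSpace ℝ E] [FiniteDimensional ℝ E]
  {H : Type*} [TopologicalSpace H] {I : ModelWithCorners ℝ E H}
  {M : Type*} [TopologicalSpace M] [ChartedSpace H M] [IsManifold I ∞ M]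
  [RiemannianBundle (fun x : M => TangentSpace I x)]
  [IsContMDiffRiemannianBundle I ∞ E (fun x : M => TangentSpace I x)]
  {x : M} {W X Y Z : Π x : M, TangentSpace I x}

namespace AlmostHermitianStructure
variable (S : AlmostHermitianStructure I M)

lemma psi_eventuallyEq (X : Π x : M, TangentSpace I x) (hY : SmoothAt I Y x)
    (Z : Π x : M, TangentSpace I x) :
    (fun y => S.psi y (X y) (Y y) (Z y)) =ᶠ[𝓝 x]
      fun y => innerCov X (S.JField Y) Z y + innerCov X Y (S.JField Z) y := by
  filter_upwards [hY.eventually_mdiffAt] with y hy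
  rw [innerCov, S.leviCivita_JField hy, inner_add_left, inner_J_left, add_assoc, psi]
  simp [innerCov, JField]

lemma mdiffAt_psi (hX : SmoothAt I X x) (hY : SmoothAt I Y x) (hZ : SmoothAt I Z x) :
    MDiffAt (fun y => S.psi y (X y) (Y y) (Z y)) x :=
  MDifferentiableAt.congr_of_eventuallyEq ((hX.mdiffAt_innerCov (S.smoothAt_JField hY) hZ).add
    (hX.mdiffAt_innerCov hY (S.smoothAt_JField hZ))) (S.psi_eventuallyEq X hY Z)

/-- The covariant derivative `(∇_W ψ)(X, Y, Z)` of the tensor `ψ`. -/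
noncomputable def covPsi (W X Y Z : Π x : M, TangentSpace I x) (x : M) : ℝ :=
  mvfderiv I (fun y => S.psi y (X y) (Y y) (Z y)) x (W x)
    - S.psi x (leviCivita I M X x (W x)) (Y x) (Z x)
    - S.psi x (X x) (leviCivita I M Y x (W x)) (Z x)
    - S.psi x (X x) (Y x) (leviCivita I M Z x (W x))

lemma covPsi_sub_swap₁₂ (hW : SmoothAt I W x) (hX : SmoothAt I X x) (hY : SmoothAt I Y x)
    (hZ : SmoothAt I Z x) : S.covPsi W X Y Z x - S.covPsi X W Y Z x =
      riem W X (S.JField Y) Z x + riem W X Y (S.JField Z) x := by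
  have hJY := S.smoothAt_JField hY
  have hJZ := S.smoothAt_JField hZ
  have d1 := mvfderiv_congr (I' := I) (S.psi_eventuallyEq X hY Z)
  have d2 := mvfderiv_congr (I' := I) (S.psi_eventuallyEq W hY Z)
  rw [mvfderiv_fun_add (hX.mdiffAt_innerCov hJY hZ) (hX.mdiffAt_innerCov hY hJZ)] at d1
  rw [mvfderiv_fun_add (hW.mdiffAt_innerCov hJY hZ) (hW.mdiffAt_innerCov hY hJZ)] at d2
  have e1 : S.psi x (mlieBracket I W X x) (Y x) (Z x) =
      innerCov (mlieBracket I W X) (S.JField Y) Z x +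
        innerCov (mlieBracket I W X) Y (S.JField Z) x :=
    (S.psi_eventuallyEq (mlieBracket I W X) hY Z).self_of_nhds
  rw [← leviCivita_sub_swap hW.mdiffAt hX.mdiffAt, psi_sub₁] at e1
  have k1 := fun v => S.leviCivita_JField hY.mdiffAt v
  have k2 := fun v => S.leviCivita_JField hZ.mdiffAt v
  have p1 : S.psi x (W x) (leviCivita I M Y x (X x)) (Z x) =
      -inner ℝ (leviCivita I M Y x (X x)) (S.covJ x (Z x) (W x)) := by
    rw [psi, inner_covJ_left]
  have p2 : S.psi x (X x) (leviCivita I M Y x (W x)) (Z x) =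
      -inner ℝ (leviCivita I M Y x (W x)) (S.covJ x (Z x) (X x)) := by
    rw [psi, inner_covJ_left]
  have j1 := S.inner_J_left x (leviCivita I M Y x (X x)) (leviCivita I M Z x (W x))
  have j2 := S.inner_J_left x (leviCivita I M Y x (W x)) (leviCivita I M Z x (X x))
  simp only [covPsi, riem, d1, d2, add_apply, k1, k2, inner_add_left, inner_add_right]
  simp only [psi] at *
  linarith

lemma covPsi_swap₃₄ (W X Y Z : Π x : M, TangentSpace I x) :
    S.covPsi W X Y Z x = -S.covPsi W X Z Y x := by
  have h : (fun y => S.psi y (X y) (Y y) (Z y)) = -fun y => S.psi y (X y) (Z y) (Y y) :=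
    funext fun y => S.psi_swap₂₃ _ _ _
  rw [covPsi, covPsi, h, mvfderiv_neg, S.psi_swap₂₃ _ (Y x) (Z x),
    S.psi_swap₂₃ _ (leviCivita I M Y x (W x)), S.psi_swap₂₃ _ (Y x), neg_apply]
  ring

lemma IsNearlyKahler.covPsi_swap₂₃ {S : AlmostHermitianStructure I M} (hS : S.IsNearlyKahler)
    (W X Y Z : Π x : M, TangentSpace I x) : S.covPsi W X Y Z x = -S.covPsi W Y X Z x := by
  have h : (fun y => S.psi y (X y) (Y y) (Z y)) = -fun y => S.psi y (Y y) (X y) (Z y) :=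
    funext fun y => hS.psi_swap₁₂ _ _ _
  rw [covPsi, covPsi, h, mvfderiv_neg, hS.psi_swap₁₂ _ (Y x) (Z x),
    hS.psi_swap₁₂ (X x), hS.psi_swap₁₂ (X x) (Y x), neg_apply]
  ring

lemma covPsi_neg₄ (W X Y : Π x : M, TangentSpace I x) (hZ : SmoothAt I Z x) :
    S.covPsi W X Y (-Z) x = -S.covPsi W X Y Z x := by
  have h : (fun y => S.psi y (X y) (Y y) ((-Z) y)) = -fun y => S.psi y (X y) (Y y) (Z y) :=
    funext fun y => S.psi_neg₃ _ _ _
  rw [covPsi, covPsi, h, mvfderiv_neg, leviCivita_neg hZ.mdiffAt]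
  simp only [Pi.neg_apply, neg_apply, psi_neg₃]
  ring

lemma covPsi_JField (W X : Π x : M, TangentSpace I x) (hY : SmoothAt I Y x)
    (hZ : SmoothAt I Z x) :
    S.covPsi W X (S.JField Y) Z x = S.covPsi W X Y (S.JField Z) x +
      S.psi x (X x) (Y x) (S.covJ x (Z x) (W x)) - S.psi x (X x) (S.covJ x (Y x) (W x)) (Z x) := by
  have h : (fun y => S.psi y (X y) (S.JField Y y) (Z y)) =
      fun y => S.psi y (X y) (Y y) (S.JField Z y) :=
    funext fun y => S.psi_J₂ _ _ _
  rw [covPsi, covPsi, h, S.leviCivita_JField hY.mdiffAt, S.leviCivita_JField hZ.mdiffAt]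
  simp only [psi_add₂, psi_add₃, JField, psi_J₂]
  ring

end AlmostHermitianStructure
end CovPsi
end NearlyKahler

namespace NearlyKahler

section CovPsi

variable {E : Type*} [NormedAddCommGroup E] [NormedSpace ℝ E] [FiniteDimensional ℝ E]
  {H : Type*} [TopologicalSpace H] {I : ModelWithCorners ℝ E H}
  {M : Type*} [TopologicalSpace M] [ChartedSpace H M] [IsManifold I ∞ M]
  [RiemannianBundle (fun x : M => TangentSpace I x)]
  [IsContMDiffRiemannianBundle I ∞ E (fun x : M => TangentSpace I x)]
  {x : M} {X Y Z : Π x : M, TangentSpace I x}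

namespace AlmostHermitianStructure

lemma IsNearlyKahler.psi_self₁₃ {S : AlmostHermitianStructure I M} (hS : S.IsNearlyKahler)
    (u v : TangentSpace I x) : S.psi x u v u = 0 := by
  rw [S.psi_swap₂₃, hS.psi_self₁₂, neg_zero]

lemma psi_self₂₃ (S : AlmostHermitianStructure I M) (u v : TangentSpace I x) :
    S.psi x u v v = 0 := by
  linarith [S.psi_swap₂₃ u v v]

lemma psi_zero₂ (S : AlmostHermitianStructure I M) (u w : TangentSpace I x) :
    S.psi x u 0 w = 0 := by
  simp [psi]

lemma psi_zero₃ (S : AlmostHermitianStructure I M) (u v : TangentSpace I x) :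
    S.psi x u v 0 = 0 := by
  simp [psi]

/-- A special case of the parallelism of `ψ` under the canonical connection. It follows from the
first Bianchi identity and the Ricci identity for `J`. -/
theorem IsNearlyKahler.covPsi_eq_zero {S : AlmostHermitianStructure I M} (hS : S.IsNearlyKahler)
    (hX : SmoothAt I X x) (hY : SmoothAt I Y x) (hZ : SmoothAt I Z x) {c : ℝ}
    (hXY : S.covJ x (Y x) (X x) = c • S.J x (Z x))
    (hYZ : S.covJ x (Z x) (Y x) = c • S.J x (X x))
    (hZX : S.covJ x (X x) (Z x) = c • S.J x (Y x)) :
    S.covPsi X X Y Z x = 0 := by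
  have hX' := S.smoothAt_JField hX
  have hY' := S.smoothAt_JField hY
  have hZ' := S.smoothAt_JField hZ
  have a23 := fun W X Y Z => hS.covPsi_swap₂₃ (x := x) W X Y Z
  have a3 : ∀ (W X Z) {Y : Π x : M, TangentSpace I x}, SmoothAt I Y x →
      S.covPsi W X (S.JField (S.JField Y)) Z x = -S.covPsi W X Y Z x := by
    intro W X Z Y hY
    rw [S.JField_JField, S.covPsi_swap₃₄, S.covPsi_neg₄ W X Z hY, S.covPsi_swap₃₄ W X Z, neg_neg]
  have a4 : ∀ (W X Y) {Z : Π x : M, TangentSpace I x}, SmoothAt I Z x →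
      S.covPsi W X Y (S.JField (S.JField Z)) x = -S.covPsi W X Y Z x := by
    intro W X Y Z hZ
    rw [S.JField_JField, S.covPsi_neg₄ W X Y hZ]
  have r3 : ∀ (W X Z) {Y : Π x : M, TangentSpace I x}, SmoothAt I Y x →
      riem W X (S.JField (S.JField Y)) Z x = -riem W X Y Z x := by
    intro W X Z Y hY
    rw [S.JField_JField, riem_neg₃ W X Z hY]
  have r4 : ∀ {W X Y Z : Π x : M, TangentSpace I x}, SmoothAt I W x → SmoothAt I X x →
      SmoothAt I Y x → SmoothAt I Z x →
      riem W X Y (S.JField (S.JField Z)) x = -riem W X Y Z x := by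
    intro W X Y Z hW hX hY hZ
    rw [riem_swap₃₄ hW hX hY (S.smoothAt_JField (S.smoothAt_JField hZ)), S.JField_JField,
      riem_neg₃ _ _ _ hZ, riem_swap₃₄ hW hX hZ hY, neg_neg]
  have hXZ : S.covJ x (Z x) (X x) = -(c • S.J x (Y x)) := by rw [hS.covJ_swap, hZX]
  have hYX : S.covJ x (X x) (Y x) = -(c • S.J x (Z x)) := by rw [hS.covJ_swap, hXY]
  have q1 := S.covPsi_JField X Z hX' hY
  have q2 := S.covPsi_JField X (S.JField Y) hX hZ
  have q3 := S.covPsi_JField (S.JField Y) X hX' hZ'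
  have q4 := S.covPsi_JField (S.JField X) Z hY hX
  simp only [JField, covJ_J, hS.covJ_J_right, hXY, hXZ, hYX, hYZ, hS x, map_neg, map_smul, S.J_J,
    psi_neg₃, psi_smul₂, psi_smul₃, psi_J₂, hS.psi_J₁, hS.psi_self₁₂, hS.psi_self₁₃,
    psi_self₂₃, psi_zero₂, psi_zero₃, map_zero, neg_zero, neg_neg, mul_zero, smul_neg, sub_zero, add_zero]
    at q1 q2 q3 q4
  linarith [
    S.covPsi_sub_swap₁₂ hX hZ hX hY, S.covPsi_sub_swap₁₂ hX hY' hZ' hX,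
    S.covPsi_sub_swap₁₂ hX' hY' hX hZ, S.covPsi_sub_swap₁₂ hX hX' hZ hY',
    S.covPsi_sub_swap₁₂ hX' hZ hY hX', S.covPsi_sub_swap₁₂ hX hZ' hX hY',
    S.covPsi_sub_swap₁₂ hX hY hX hZ, riem_bianchi hX hX' hZ hY, riem_bianchi hX hX' hZ' hY', q1,
    q2, q3, q4, r3 X (S.JField Y) X hZ, r4 hX hX' hZ hY, r4 hX' hZ hY hX, r4 hX hZ' hX hY,
    a3 X Z Y hX, a3 (S.JField Y) X (S.JField Z) hX, a4 (S.JField Y) X (S.JField X) hZ,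
    S.covPsi_swap₃₄ (x := x) X (S.JField X) Z (S.JField Y), a23 X Y X Z,
    a23 X (S.JField Y) X (S.JField Z), a23 X (S.JField Y) (S.JField X) Z,
    S.covPsi_swap₃₄ (x := x) X (S.JField Y) (S.JField Z) X, a23 X Z X Y,
    S.covPsi_swap₃₄ (x := x) X X Z Y, a23 X Z (S.JField X) (S.JField Y),
    a23 X (S.JField Z) X (S.JField Y), S.covPsi_swap₃₄ (x := x) X X (S.JField Z) (S.JField Y),
    S.covPsi_swap₃₄ (x := x) (S.JField X) X Z (S.JField Y), a23 (S.JField X) (S.JField Y) X Z,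
    a23 (S.JField X) Z Y (S.JField X), S.covPsi_swap₃₄ (x := x) (S.JField X) Y Z (S.JField X),
    a23 (S.JField X) Y (S.JField X) Z, a23 (S.JField X) Z (S.JField Y) X,
    S.covPsi_swap₃₄ (x := x) (S.JField X) (S.JField Y) Z X, a23 Y X X Z,
    a23 (S.JField Y) X X (S.JField Z), S.covPsi_swap₃₄ (x := x) (S.JField Y) X (S.JField Z) X,
    a23 (S.JField Y) (S.JField X) X Z, a23 Z X X Y,
    S.covPsi_swap₃₄ (x := x) Z (S.JField X) Y (S.JField X), a23 Z (S.JField X) (S.JField X) Y,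
    a23 (S.JField Z) X X (S.JField Y), riem_swap₃₄ hX hX' hZ hY, riem_swap₃₄ hX hX' hZ' hY',
    riem_swap₃₄ hX hY' hZ hX, riem_swap₃₄ hX hY' hZ' hX', riem_pair_symm hX hZ hX hY',
    riem_pair_symm hX hZ' hX hY, riem_pair_symm hX' hY' hX hZ', riem_pair_symm hX' hZ hX hY,
    riem_swap₃₄ hX' hZ hY hX, riem_swap₃₄ hX' hZ hY' hX', riem_pair_symm hX' hZ hX' hY',
    riem_pair_symm hX' hZ' hX hY', riem_swap₁₂ (x := x) Z X (S.JField X) Y,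
    riem_swap₁₂ (x := x) (S.JField Z) X (S.JField X) (S.JField Y)]

end AlmostHermitianStructure
end CovPsi
end NearlyKahler

namespace NearlyKahler

section Pullback

variable {E : Type*} [NormedAddCommGroup E] [NormedSpace ℝ E] [FiniteDimensional ℝ E]
  {H : Type*} [TopologicalSpace H] {I : ModelWithCorners ℝ E H}
  {M : Type*} [TopologicalSpace M] [ChartedSpace H M] [IsManifold I ∞ M]
  {n : ℕ} {L : Type*} [TopologicalSpace L] [ChartedSpace (EuclideanSpace ℝ (Fin n)) L]
  [IsManifold (𝓡 n) ∞ L]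
  {f : L → M} {p : L} {V : Π p : L, TangentSpace I (f p)}

lemma trivComp_sum {x y : M} (hy : y ∈ (trivializationAt E (fun x : M => TangentSpace I x) x).baseSet)
    {ι : Type*} (s : Finset ι) (v : ι → TangentSpace I y) :
    trivComp x y (∑ i ∈ s, v i) = ∑ i ∈ s, trivComp x y (v i) :=
  map_sum ((trivializationAt E (fun x : M => TangentSpace I x) x).linear ℝ hy).mk' _ s

lemma trivComp_injective {x y : M}
    (hy : y ∈ (trivializationAt E (fun x : M => TangentSpace I x) x).baseSet)
    {v w : TangentSpace I y} (h : trivComp x y v = trivComp x y w) : v = w := by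
  rw [← (trivializationAt E (fun x : M => TangentSpace I x) x).symm_apply_apply_mk hy v,
    ← (trivializationAt E (fun x : M => TangentSpace I x) x).symm_apply_apply_mk hy w]
  exact congrArg _ h

lemma trivComp_symmL {x : M} (v : E) :
    trivComp x x ((trivializationAt E (fun x : M => TangentSpace I x) x).symmL ℝ x v) = v := by
  have hx := FiberBundle.mem_baseSet_trivializationAt E (fun x : M => TangentSpace I x) x
  rw [trivComp, Trivialization.symmL_apply _ hx, Trivialization.apply_mk_symm _ hx]

lemma eventually_extend_add {x : M} (v w : TangentSpace I x) :
    ∀ᶠ y in 𝓝 x, FiberBundle.extend E (v + w) y =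
      FiberBundle.extend E v y + FiberBundle.extend E w y := by
  filter_upwards [baseSet_mem_nhds (I := I) x] with y hy
  refine trivComp_injective hy ?_
  have hx := FiberBundle.mem_baseSet_trivializationAt E (fun x : M => TangentSpace I x) x
  rw [trivComp_add hy, trivComp_extend hy, trivComp_extend hy, trivComp_extend hy,
    trivComp_add hx]

lemma eventually_extend_smul {x : M} (c : ℝ) (v : TangentSpace I x) :
    ∀ᶠ y in 𝓝 x, FiberBundle.extend E (c • v) y =
      c • FiberBundle.extend E v y := by
  filter_upwards [baseSet_mem_nhds (I := I) x] with y hy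
  refine trivComp_injective hy ?_
  have hx := FiberBundle.mem_baseSet_trivializationAt E (fun x : M => TangentSpace I x) x
  rw [trivComp_smul hy, trivComp_extend hy, trivComp_extend hy, trivComp_smul hx]

lemma mvfderiv_fun_sum {ι : Type*} (s : Finset ι) {g : ι → L → ℝ}
    (hg : ∀ i ∈ s, MDifferentiableAt (𝓡 n) 𝓘(ℝ, ℝ) (g i) p) :
    MDifferentiableAt (𝓡 n) 𝓘(ℝ, ℝ) (fun q => ∑ i ∈ s, g i q) p ∧
      mvfderiv (𝓡 n) (fun q => ∑ i ∈ s, g i q) p = ∑ i ∈ s, mvfderiv (𝓡 n) (g i) p := by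
  classical
  induction s using Finset.induction_on with
  | empty => exact ⟨by simpa using mdifferentiableAt_const, by simpa using mvfderiv_const (0 : ℝ)⟩
  | insert i s hi ih =>
    obtain ⟨h1, h2⟩ := ih fun j hj => hg j (Finset.mem_insert_of_mem hj)
    have h3 := hg i (Finset.mem_insert_self i s)
    simp only [Finset.sum_insert hi]
    exact ⟨h3.add h1, by rw [mvfderiv_fun_add h3 h1, h2]⟩

variable [RiemannianBundle (fun x : M => TangentSpace I x)]
  [IsContMDiffRiemannianBundle I ∞ E (fun x : M => TangentSpace I x)]

/-- A differentiable vector field along `f` is a combination of coordinate fields with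
differentiable coefficients. -/
lemma eventually_eq_sum_extend (hf : ContinuousAt f p) (V : Π p : L, TangentSpace I (f p))
    {ι : Type*} [Fintype ι] (b : Module.Basis ι ℝ E) :
    ∀ᶠ q in 𝓝 p, V q = ∑ k, b.repr (trivComp (f p) (f q) (V q)) k • FiberBundle.extend E
      ((trivializationAt E (fun x : M => TangentSpace I x) (f p)).symmL ℝ (f p) (b k)) (f q) := by
  filter_upwards [eventually_mem_baseSet (I := I) hf] with q hq
  refine trivComp_injective hq ?_
  simp_rw [trivComp_sum hq, trivComp_smul hq, trivComp_extend hq, trivComp_symmL]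
  exact (b.sum_repr _).symm

/-- The derivative of a covector field `φ` along `f` applied to a vector field `V` along `f`,
if it is known for the coordinate fields. -/
theorem mvfderiv_along_of_extend
    (hV : MDifferentiableAt (𝓡 n) I.tangent (fun q => (⟨f q, V q⟩ : TangentBundle I M)) p)
    (φ : Π q : L, TangentSpace I (f q) →ₗ[ℝ] ℝ) (l : TangentSpace I (f p) →ₗ[ℝ] ℝ)
    (u : TangentSpace (𝓡 n) p)
    (hd : ∀ v : TangentSpace I (f p),
      MDifferentiableAt (𝓡 n) 𝓘(ℝ, ℝ) (fun q => φ q (FiberBundle.extend E v (f q))) p)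
    (hφ : ∀ v : TangentSpace I (f p),
      mvfderiv (𝓡 n) (fun q => φ q (FiberBundle.extend E v (f q))) p u = l v +
        φ p (leviCivita I M (FiberBundle.extend E v) (f p) (mfderiv (𝓡 n) I f p u))) :
    MDifferentiableAt (𝓡 n) 𝓘(ℝ, ℝ) (fun q => φ q (V q)) p ∧
      mvfderiv (𝓡 n) (fun q => φ q (V q)) p u = l (V p) + φ p (pullbackDeriv f V p u) := by
  have hf : ContinuousAt f p := ((mdifferentiableAt_totalSpace I _).1 hV).1.continuousAt
  let b := Module.finBasis ℝ E
  let T := (trivializationAt E (fun x : M => TangentSpace I x) (f p)).symmL ℝ (f p)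
  let c := fun k (q : L) => b.coord k (trivComp (f p) (f q) (V q))
  have hc : ∀ k, MDifferentiableAt (𝓡 n) 𝓘(ℝ, ℝ) (c k) p := fun k =>
    ((b.coord k).toContinuousLinearMap.mdifferentiableAt).comp p (mdiff_trivComp hV)
  have hdc : ∀ k, mvfderiv (𝓡 n) (c k) p u =
      b.coord k (mvfderiv (𝓡 n) (fun q : L => trivComp (f p) (f q) (V q)) p u) := fun k =>
    mvfderiv_clm_comp (b.coord k).toContinuousLinearMap (mdiff_trivComp hV) u
  have hVe : ∀ᶠ q in 𝓝 p, V q = ∑ k, c k q • FiberBundle.extend E (T (b k)) (f q) :=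
    eventually_eq_sum_extend hf V b
  have he : (fun q => φ q (V q)) =ᶠ[𝓝 p]
      fun q => ∑ k, c k q * φ q (FiberBundle.extend E (T (b k)) (f q)) := by
    filter_upwards [hVe] with q hq
    rw [hq, map_sum]
    simp
  obtain ⟨h1, h2⟩ := mvfderiv_fun_sum Finset.univ fun k _ => (hc k).mul (hd (T (b k)))
  refine ⟨h1.congr_of_eventuallyEq he, ?_⟩
  rw [mvfderiv_congr he]
  have h2' := congrArg (fun A : TangentSpace (𝓡 n) p →L[ℝ] ℝ => A u) h2
  have hp := hVe.self_of_nhds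
  simp only [FiberBundle.extend_apply_self] at hp
  let D : TangentSpace I (f p) →ₗ[ℝ] TangentSpace I (f p) :=
    { toFun := fun v => leviCivita I M (FiberBundle.extend E v) (f p) (mfderiv (𝓡 n) I f p u)
      map_add' := fun v w => by rw [leviCivita_extend_add, add_apply]
      map_smul' := fun a v => by rw [leviCivita_extend_smul]; rfl }
  have hD : pullbackDeriv f V p u = T (mvfderiv (𝓡 n) (fun q => trivComp (f p) (f q) (V q)) p u) +
      D (V p) := rfl
  have hT : T (mvfderiv (𝓡 n) (fun q => trivComp (f p) (f q) (V q)) p u) =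
      ∑ k, mvfderiv (𝓡 n) (c k) p u • T (b k) := by
    simp_rw [hdc, ← map_smul, ← map_sum]
    exact congrArg T (b.sum_repr _).symm
  have hk : ∀ k, mvfderiv (𝓡 n) (c k * fun q => φ q (FiberBundle.extend E (T (b k)) (f q))) p u =
      c k p * (l (T (b k)) + φ p (D (T (b k)))) +
        mvfderiv (𝓡 n) (c k) p u * φ p (T (b k)) := fun k => by
    rw [mvfderiv_mul (hc k) (hd (T (b k)))]
    simp only [add_apply, smul_apply, smul_eq_mul, hφ, FiberBundle.extend_apply_self]
    rw [mul_comm (φ p (T (b k)))]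
    rfl
  rw [hD, hT]
  nth_rw 1 2 [hp]
  refine h2'.trans ?_
  simp only [sum_apply, hk, map_add, map_sum, map_smul, smul_eq_mul, mul_add,
    Finset.sum_add_distrib]
  ring

end Pullback
end NearlyKahler

namespace NearlyKahler

section Symmetry

variable {E : Type*} [NormedAddCommGroup E] [NormedSpace ℝ E] [FiniteDimensional ℝ E]
  {H : Type*} [TopologicalSpace H] {I : ModelWithCorners ℝ E H}
  {M : Type*} [TopologicalSpace M] [ChartedSpace H M] [IsManifold I ∞ M]
  {n : ℕ} {L : Type*} [TopologicalSpace L] [ChartedSpace (EuclideanSpace ℝ (Fin n)) L]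
  [IsManifold (𝓡 n) ∞ L]
  {f : L → M} {p : L}

lemma trivComp_eq_mvfderiv {x y : M} (hy : y ∈ (chartAt H x).source) (v : TangentSpace I y) :
    trivComp x y v = mvfderiv I (extChartAt I x) y v := by
  have h := TangentBundle.continuousLinearMapAt_trivializationAt (I := I) hy
  have hb : y ∈ (trivializationAt E (fun x : M => TangentSpace I x) x).baseSet := hy
  have h2 : (trivializationAt E (fun x : M => TangentSpace I x) x).continuousLinearMapAt ℝ y v =
      trivComp x y v := by
    rw [trivComp, Trivialization.continuousLinearMapAt_apply,
      Trivialization.coe_linearMapAt_of_mem _ hb]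
  exact h2.symm.trans (congrArg (fun A : TangentSpace I y →L[ℝ] E => A v) h)

lemma mlieBracket_extend {x : M} (v w : TangentSpace I x) :
    mlieBracket I (FiberBundle.extend E v) (FiberBundle.extend E w) x = 0 := by
  have hx := mem_chart_source H x
  have hg : CMDiffAt ∞ (extChartAt I x) x := contMDiffAt_extChartAt
  have h := mvfderiv_mlieBracket_vector (smoothAt_extend v) (smoothAt_extend w) hg
  have hc : ∀ u v : TangentSpace I x,
      mvfderiv I (fun y => mvfderiv I (extChartAt I x) y (FiberBundle.extend E u y)) x v = 0 := by
    intro u v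
    have e : (fun y => mvfderiv I (extChartAt I x) y (FiberBundle.extend E u y)) =ᶠ[𝓝 x]
        fun _ => trivComp x x u := by
      filter_upwards [baseSet_mem_nhds (I := I) x, (chartAt H x).open_source.mem_nhds hx]
        with y hy hy'
      rw [← trivComp_eq_mvfderiv hy', trivComp_extend hy]
    rw [mvfderiv_congr e, mvfderiv_const]
    rfl
  rw [FiberBundle.extend_apply_self, FiberBundle.extend_apply_self, hc, hc, sub_zero,
    ← trivComp_eq_mvfderiv hx] at h
  have hb := FiberBundle.mem_baseSet_trivializationAt E (fun x : M => TangentSpace I x) x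
  refine trivComp_injective hb (h.trans ?_)
  rw [← zero_smul ℝ (0 : TangentSpace I x), trivComp_smul hb, zero_smul]

lemma mdiffAt_pushforward (hf : ContMDiff (𝓡 n) I ∞ f) {Y : Π p : L, TangentSpace (𝓡 n) p}
    (hY : MDifferentiableAt (𝓡 n) (𝓡 n).tangent (fun q => (⟨q, Y q⟩ : TangentBundle (𝓡 n) L)) p) :
    MDifferentiableAt (𝓡 n) I.tangent
      (fun q => (⟨f q, mfderiv (𝓡 n) I f q (Y q)⟩ : TangentBundle I M)) p :=
  ((hf.contMDiff_tangentMap (m := 1) (by norm_cast)).mdifferentiable (by norm_num) _).comp p hY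

variable [RiemannianBundle (fun x : M => TangentSpace I x)]
  [IsContMDiffRiemannianBundle I ∞ E (fun x : M => TangentSpace I x)]

variable (I) in
/-- The derivative `∇_u (df Y)` along `f`, where `Y` is the coordinate field with `Y p = v`. -/
noncomputable def pushDeriv (f : L → M) (p : L) (u v : TangentSpace (𝓡 n) p) :
    TangentSpace I (f p) :=
  pullbackDeriv (I := I) f (fun q => mfderiv (𝓡 n) I f q
    (FiberBundle.extend (EuclideanSpace ℝ (Fin n)) v q)) p u

lemma leviCivita_extend_symm {x : M} (v w : TangentSpace I x) :
    leviCivita I M (FiberBundle.extend E w) x v = leviCivita I M (FiberBundle.extend E v) x w := by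
  have h := leviCivita_sub_swap (smoothAt_extend v).mdiffAt (smoothAt_extend w).mdiffAt
  rw [mlieBracket_extend, FiberBundle.extend_apply_self, FiberBundle.extend_apply_self] at h
  exact sub_eq_zero.1 h

/-- The connection along `f` is torsion-free. -/
theorem pushDeriv_symm (hf : ContMDiff (𝓡 n) I ∞ f) (u v : TangentSpace (𝓡 n) p) :
    pushDeriv I f p u v = pushDeriv I f p v u := by
  let g : L → E := fun q => extChartAt I (f p) (f q)
  have hg : ContMDiffAt (𝓡 n) 𝓘(ℝ, E) ∞ g p := contMDiffAt_extChartAt.comp p (hf p)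
  have h := mvfderiv_mlieBracket_vector (smoothAt_extend u) (smoothAt_extend v) hg
  rw [mlieBracket_extend, map_zero, FiberBundle.extend_apply_self,
    FiberBundle.extend_apply_self] at h
  have hs : ∀ᶠ q in 𝓝 p, f q ∈ (chartAt H (f p)).source :=
    (hf p).continuousAt.eventually_mem
      ((chartAt H (f p)).open_source.mem_nhds (mem_chart_source H (f p)))
  have e : ∀ w : TangentSpace (𝓡 n) p,
      (fun q => trivComp (f p) (f q) (mfderiv (𝓡 n) I f q
        (FiberBundle.extend (EuclideanSpace ℝ (Fin n)) w q) : TangentSpace I (f q))) =ᶠ[𝓝 p]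
      fun q => mvfderiv (𝓡 n) g q (FiberBundle.extend (EuclideanSpace ℝ (Fin n)) w q) := by
    intro w
    filter_upwards [hs] with q hq
    rw [trivComp_eq_mvfderiv hq]
    exact (mfderiv_comp_apply q ((contMDiffAt_extChartAt' hq).mdifferentiableAt (n := ∞) (by simp))
      ((hf q).mdifferentiableAt (by simp)) _).symm
  simp only [pushDeriv, pullbackDeriv, add_apply, ContinuousLinearMap.comp_apply,
    FiberBundle.extend_apply_self]
  rw [mvfderiv_congr (e u), mvfderiv_congr (e v), sub_eq_zero.1 h.symm, leviCivita_extend_symm]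

end Symmetry
end NearlyKahler

namespace NearlyKahler

section Along

variable {E : Type*} [NormedAddCommGroup E] [NormedSpace ℝ E] [FiniteDimensional ℝ E]
  {H : Type*} [TopologicalSpace H] {I : ModelWithCorners ℝ E H}
  {M : Type*} [TopologicalSpace M] [ChartedSpace H M] [IsManifold I ∞ M]
  {n : ℕ} {L : Type*} [TopologicalSpace L] [ChartedSpace (EuclideanSpace ℝ (Fin n)) L]
  [IsManifold (𝓡 n) ∞ L]
  [RiemannianBundle (fun x : M => TangentSpace I x)]
  [IsContMDiffRiemannianBundle I ∞ E (fun x : M => TangentSpace I x)]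
  {f : L → M} {p : L} {V V₁ V₂ V₃ : Π p : L, TangentSpace I (f p)}

namespace AlmostHermitianStructure
variable {S : AlmostHermitianStructure I M}

lemma mvfderiv_along_comp (hf : MDifferentiableAt (𝓡 n) I f p) {g : M → ℝ} (hg : MDiffAt g (f p))
    (u : TangentSpace (𝓡 n) p) :
    MDifferentiableAt (𝓡 n) 𝓘(ℝ, ℝ) (fun q => g (f q)) p ∧
      mvfderiv (𝓡 n) (fun q => g (f q)) p u = mvfderiv I g (f p) (mfderiv (𝓡 n) I f p u) :=
  ⟨hg.comp p hf, mfderiv_comp_apply p hg hf u⟩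

/-- The derivative of `ω(V₁, V₂)` for vector fields `V₁`, `V₂` along `f`. -/
theorem mvfderiv_fundamentalForm_along
    (h₁ : MDifferentiableAt (𝓡 n) I.tangent (fun q => (⟨f q, V₁ q⟩ : TangentBundle I M)) p)
    (h₂ : MDifferentiableAt (𝓡 n) I.tangent (fun q => (⟨f q, V₂ q⟩ : TangentBundle I M)) p)
    (u : TangentSpace (𝓡 n) p) :
    mvfderiv (𝓡 n) (fun q => S.fundamentalForm (f q) (V₁ q) (V₂ q)) p u =
      S.psi (f p) (mfderiv (𝓡 n) I f p u) (V₁ p) (V₂ p)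
        + inner ℝ (S.J (f p) (pullbackDeriv f V₁ p u)) (V₂ p)
        + inner ℝ (S.J (f p) (V₁ p)) (pullbackDeriv f V₂ p u) := by
  have hf : MDifferentiableAt (𝓡 n) I f p := ((mdifferentiableAt_totalSpace I _).1 h₁).1
  set U := mfderiv (𝓡 n) I f p u
  have hd := fun v w : TangentSpace I (f p) => mvfderiv_along_comp hf
    (mdiff_inner (S.smoothAt_JField (smoothAt_extend v)).mdiffAt (smoothAt_extend w).mdiffAt) u
  have hU := (smoothAt_extend U).mdiffAt
  have h : ∀ w : TangentSpace I (f p), _ := fun w =>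
    mvfderiv_along_of_extend h₁
      (fun q => (innerₗ (TangentSpace I (f q))).flip (FiberBundle.extend E w (f q)) ∘ₗ
        (S.J (f q)).toLinearMap)
      ((innerₗ (TangentSpace I (f p))).flip w ∘ₗ ((S.covJ (f p)).flip U).toLinearMap +
        (innerₗ (TangentSpace I (f p))).flip (leviCivita I M (FiberBundle.extend E w) (f p) U) ∘ₗ
          (S.J (f p)).toLinearMap) u (fun v => (hd v w).1) (fun v => by
        have hm := leviCivita_metric hU (S.smoothAt_JField (smoothAt_extend v)).mdiffAt
          (smoothAt_extend w).mdiffAt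
        rw [S.leviCivita_JField (smoothAt_extend v).mdiffAt] at hm
        simp only [FiberBundle.extend_apply_self, JField] at hm
        rw [inner_add_left] at hm
        refine ((hd v w).2.trans hm).trans ?_
        change _ = inner ℝ (S.covJ (f p) v U) w +
          inner ℝ (S.J (f p) v) (leviCivita I M (FiberBundle.extend E w) (f p) U) +
          inner ℝ (S.J (f p) (leviCivita I M (FiberBundle.extend E v) (f p) U))
            (FiberBundle.extend E w (f p))
        rw [FiberBundle.extend_apply_self]
        ring)
  have h' := mvfderiv_along_of_extend h₂
    (fun q => innerₗ (TangentSpace I (f q)) (S.J (f q) (V₁ q)))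
    (innerₗ (TangentSpace I (f p)) (S.covJ (f p) (V₁ p) U + S.J (f p) (pullbackDeriv f V₁ p u))) u
    (fun w => (h w).1) (fun w => by
      refine (h w).2.trans ?_
      change inner ℝ (S.covJ (f p) (V₁ p) U) w +
          inner ℝ (S.J (f p) (V₁ p)) (leviCivita I M (FiberBundle.extend E w) (f p) U) +
          inner ℝ (S.J (f p) (pullbackDeriv f V₁ p u)) (FiberBundle.extend E w (f p)) =
        inner ℝ (S.covJ (f p) (V₁ p) U + S.J (f p) (pullbackDeriv f V₁ p u)) w +
          inner ℝ (S.J (f p) (V₁ p)) (leviCivita I M (FiberBundle.extend E w) (f p) U)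
      rw [FiberBundle.extend_apply_self, inner_add_left]
      ring)
  refine h'.2.trans ?_
  simp [psi, U]

/-- The tensor `∇ψ` at `x`, evaluated on coordinate fields. -/
noncomputable def covPsiAt (S : AlmostHermitianStructure I M) (x : M)
    (u v w z : TangentSpace I x) : ℝ :=
  S.covPsi (FiberBundle.extend E u) (FiberBundle.extend E v) (FiberBundle.extend E w)
    (FiberBundle.extend E z) x

section CovPsiAt
variable {x : M}

lemma covPsiAt_add₄ (u v w z z' : TangentSpace I x) :
    S.covPsiAt x u v w (z + z') = S.covPsiAt x u v w z + S.covPsiAt x u v w z' := by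
  have h : (fun y => S.psi y (FiberBundle.extend E v y) (FiberBundle.extend E w y)
      (FiberBundle.extend E (z + z') y)) =ᶠ[𝓝 x]
      fun y => S.psi y (FiberBundle.extend E v y) (FiberBundle.extend E w y)
        (FiberBundle.extend E z y) + S.psi y (FiberBundle.extend E v y) (FiberBundle.extend E w y)
        (FiberBundle.extend E z' y) := by
    filter_upwards [eventually_extend_add z z'] with y hy
    rw [hy, psi_add₃]
  simp only [covPsiAt, covPsi]
  rw [mvfderiv_congr h, mvfderiv_fun_add
    (S.mdiffAt_psi (smoothAt_extend v) (smoothAt_extend w) (smoothAt_extend z))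
    (S.mdiffAt_psi (smoothAt_extend v) (smoothAt_extend w) (smoothAt_extend z')),
    leviCivita_extend_add]
  simp only [FiberBundle.extend_apply_self, add_apply, psi_add₃]
  ring

lemma covPsiAt_smul₄ (u v w z : TangentSpace I x) (c : ℝ) :
    S.covPsiAt x u v w (c • z) = c * S.covPsiAt x u v w z := by
  have h : (fun y => S.psi y (FiberBundle.extend E v y) (FiberBundle.extend E w y)
      (FiberBundle.extend E (c • z) y)) =ᶠ[𝓝 x]
      fun y => c * S.psi y (FiberBundle.extend E v y) (FiberBundle.extend E w y)
        (FiberBundle.extend E z y) := by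
    filter_upwards [eventually_extend_smul c z] with y hy
    rw [hy, psi_smul₃]
  simp only [covPsiAt, covPsi]
  rw [mvfderiv_congr h, mvfderiv_fun_mul mdifferentiableAt_const
    (S.mdiffAt_psi (smoothAt_extend v) (smoothAt_extend w) (smoothAt_extend z)),
    leviCivita_extend_smul, mvfderiv_const]
  simp only [FiberBundle.extend_apply_self, smul_apply, psi_smul₃, smul_zero, add_zero,
    smul_eq_mul]
  ring

lemma IsNearlyKahler.covPsiAt_rotate (hS : S.IsNearlyKahler) (u v w z : TangentSpace I x) :
    S.covPsiAt x u v w z = S.covPsiAt x u w z v := by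
  rw [covPsiAt, hS.covPsi_swap₂₃, S.covPsi_swap₃₄, neg_neg, covPsiAt]

variable (S) in
/-- `∇ψ` as a linear form in the last argument. -/
noncomputable def covPsiLin (x : M) (u v w : TangentSpace I x) : TangentSpace I x →ₗ[ℝ] ℝ where
  toFun := S.covPsiAt x u v w
  map_add' := covPsiAt_add₄ u v w
  map_smul' c z := covPsiAt_smul₄ u v w z c

variable (S) in
/-- `ψ` as a linear form in the last argument. -/
noncomputable def psiLin (x : M) (u v : TangentSpace I x) : TangentSpace I x →ₗ[ℝ] ℝ :=
  innerₗ (TangentSpace I x) (S.covJ x v u)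

lemma IsNearlyKahler.psi_rotate (hS : S.IsNearlyKahler) (u v w : TangentSpace I x) :
    S.psi x u v w = S.psi x v w u := by
  rw [hS.psi_swap₁₂, S.psi_swap₂₃, neg_neg]

end CovPsiAt

/-- The derivative of `ψ(V₁, V₂, V₃)` for vector fields along `f`. -/
theorem IsNearlyKahler.mvfderiv_psi_along (hS : S.IsNearlyKahler)
    (h₁ : MDifferentiableAt (𝓡 n) I.tangent (fun q => (⟨f q, V₁ q⟩ : TangentBundle I M)) p)
    (h₂ : MDifferentiableAt (𝓡 n) I.tangent (fun q => (⟨f q, V₂ q⟩ : TangentBundle I M)) p)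
    (h₃ : MDifferentiableAt (𝓡 n) I.tangent (fun q => (⟨f q, V₃ q⟩ : TangentBundle I M)) p)
    (u : TangentSpace (𝓡 n) p) :
    MDifferentiableAt (𝓡 n) 𝓘(ℝ, ℝ) (fun q => S.psi (f q) (V₁ q) (V₂ q) (V₃ q)) p ∧
    mvfderiv (𝓡 n) (fun q => S.psi (f q) (V₁ q) (V₂ q) (V₃ q)) p u =
      S.covPsiAt (f p) (mfderiv (𝓡 n) I f p u) (V₁ p) (V₂ p) (V₃ p)
        + S.psi (f p) (pullbackDeriv f V₁ p u) (V₂ p) (V₃ p)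
        + S.psi (f p) (V₁ p) (pullbackDeriv f V₂ p u) (V₃ p)
        + S.psi (f p) (V₁ p) (V₂ p) (pullbackDeriv f V₃ p u) := by
  have hf : MDifferentiableAt (𝓡 n) I f p := ((mdifferentiableAt_totalSpace I _).1 h₁).1
  set U := mfderiv (𝓡 n) I f p u with hU
  have hd := fun v w z : TangentSpace I (f p) => mvfderiv_along_comp hf
    (S.mdiffAt_psi (smoothAt_extend v) (smoothAt_extend w) (smoothAt_extend z)) u
  let D := fun v : TangentSpace I (f p) => leviCivita I M (FiberBundle.extend E v) (f p) U
  have k₁ : ∀ w z : TangentSpace I (f p), _ := fun w z =>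
    mvfderiv_along_of_extend h₁
      (fun q => S.psiLin (f q) (FiberBundle.extend E w (f q)) (FiberBundle.extend E z (f q)))
      (S.covPsiLin (f p) U w z + S.psiLin (f p) (D w) z + S.psiLin (f p) w (D z)) u
      (fun v => by
        refine (hd v w z).1.congr_of_eventuallyEq (Filter.Eventually.of_forall fun q => ?_)
        exact (hS.psi_rotate _ _ _).symm)
      (fun v => by
        have e : (fun q => S.psiLin (f q) (FiberBundle.extend E w (f q))
            (FiberBundle.extend E z (f q)) (FiberBundle.extend E v (f q))) =
          fun q => S.psi (f q) (FiberBundle.extend E v (f q)) (FiberBundle.extend E w (f q))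
            (FiberBundle.extend E z (f q)) := funext fun q => (hS.psi_rotate _ _ _).symm
        rw [e, (hd v w z).2]
        have hc : S.covPsiAt (f p) U w z v = S.covPsiAt (f p) U v w z :=
          (hS.covPsiAt_rotate U v w z).symm
        have r := fun a b c => hS.psi_rotate (x := f p) a b c
        change _ = S.covPsiAt (f p) U w z v + S.psi _ _ _ _ + S.psi _ _ _ _ + S.psi _ _ _ _
        rw [hc, covPsiAt, covPsi, ← r v, ← r v, ← r (D v)]
        simp only [FiberBundle.extend_apply_self, D, ← hU]
        ring)
  have k₂ : ∀ z : TangentSpace I (f p), _ := fun z =>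
    mvfderiv_along_of_extend h₂
      (fun q => S.psiLin (f q) (FiberBundle.extend E z (f q)) (V₁ q))
      (S.covPsiLin (f p) U z (V₁ p) + S.psiLin (f p) (D z) (V₁ p) +
        S.psiLin (f p) z (pullbackDeriv f V₁ p u)) u
      (fun w => by
        refine (k₁ w z).1.congr_of_eventuallyEq (Filter.Eventually.of_forall fun q => ?_)
        exact (hS.psi_rotate _ _ _).symm)
      (fun w => by
        have e : (fun q => S.psiLin (f q) (FiberBundle.extend E z (f q)) (V₁ q)
            (FiberBundle.extend E w (f q))) =
          fun q => S.psiLin (f q) (FiberBundle.extend E w (f q)) (FiberBundle.extend E z (f q))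
            (V₁ q) := funext fun q => (hS.psi_rotate _ _ _).symm
        rw [e, (k₁ w z).2]
        change S.covPsiAt (f p) U w z (V₁ p) + S.psi (f p) (D w) z (V₁ p) +
            S.psi (f p) w (D z) (V₁ p) + S.psi (f p) (FiberBundle.extend E w (f p))
              (FiberBundle.extend E z (f p)) (pullbackDeriv f V₁ p u) =
          S.covPsiAt (f p) U z (V₁ p) w + S.psi (f p) (D z) (V₁ p) w +
            S.psi (f p) z (pullbackDeriv f V₁ p u) w + S.psi (f p)
              (FiberBundle.extend E z (f p)) (V₁ p) (D w)
        rw [FiberBundle.extend_apply_self, FiberBundle.extend_apply_self,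
          hS.covPsiAt_rotate U w, hS.psi_rotate (D w), hS.psi_rotate w (D z), hS.psi_rotate w z]
        ring)
  have k₃ := mvfderiv_along_of_extend h₃ (fun q => S.psiLin (f q) (V₁ q) (V₂ q))
      (S.covPsiLin (f p) U (V₁ p) (V₂ p) + S.psiLin (f p) (pullbackDeriv f V₁ p u) (V₂ p) +
        S.psiLin (f p) (V₁ p) (pullbackDeriv f V₂ p u)) u
      (fun z => by
        refine (k₂ z).1.congr_of_eventuallyEq (Filter.Eventually.of_forall fun q => ?_)
        exact (hS.psi_rotate _ _ _).symm)
      (fun z => by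
        have e : (fun q => S.psiLin (f q) (V₁ q) (V₂ q) (FiberBundle.extend E z (f q))) =
          fun q => S.psiLin (f q) (FiberBundle.extend E z (f q)) (V₁ q) (V₂ q) :=
            funext fun q => (hS.psi_rotate _ _ _).symm
        rw [e, (k₂ z).2]
        change S.covPsiAt (f p) U z (V₁ p) (V₂ p) + S.psi (f p) (D z) (V₁ p) (V₂ p) +
            S.psi (f p) z (pullbackDeriv f V₁ p u) (V₂ p) + S.psi (f p)
              (FiberBundle.extend E z (f p)) (V₁ p) (pullbackDeriv f V₂ p u) =
          S.covPsiAt (f p) U (V₁ p) (V₂ p) z + S.psi (f p) (pullbackDeriv f V₁ p u) (V₂ p) z +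
            S.psi (f p) (V₁ p) (pullbackDeriv f V₂ p u) z + S.psi (f p) (V₁ p) (V₂ p) (D z)
        rw [FiberBundle.extend_apply_self, hS.covPsiAt_rotate U z, hS.psi_rotate (D z),
          hS.psi_rotate z (pullbackDeriv f V₁ p u), hS.psi_rotate z (V₁ p)]
        ring)
  exact k₃

end AlmostHermitianStructure
end Along
end NearlyKahler

namespace NearlyKahler

section Lagrangian

variable {E : Type*} [NormedAddCommGroup E] [NormedSpace ℝ E] [FiniteDimensional ℝ E]
  {H : Type*} [TopologicalSpace H] {I : ModelWithCorners ℝ E H}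
  {M : Type*} [TopologicalSpace M] [ChartedSpace H M] [IsManifold I ∞ M]
  {n : ℕ} {L : Type*} [TopologicalSpace L] [ChartedSpace (EuclideanSpace ℝ (Fin n)) L]
  [IsManifold (𝓡 n) ∞ L]
  [RiemannianBundle (fun x : M => TangentSpace I x)]
  [IsContMDiffRiemannianBundle I ∞ E (fun x : M => TangentSpace I x)]
  {f : L → M} {p : L}

namespace AlmostHermitianStructure
variable {S : AlmostHermitianStructure I M}

lemma canonicalTorsion_apply (x : M) (u v : TangentSpace I x) (hS : S.IsNearlyKahler) :
    S.canonicalTorsion x u v = -S.J x (S.covJ x v u) := by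
  have hu := (smoothAt_extend u).mdiffAt
  have hv := (smoothAt_extend v).mdiffAt
  have h := S.canonicalConnection.torsion_apply hu hv
  rw [← leviCivita_sub_swap hu hv, canonicalConnection_apply, canonicalConnection_apply] at h
  simp only [FiberBundle.extend_apply_self] at h
  rw [canonicalTorsion, h, hS.covJ_swap v u, map_neg]
  module

variable (S) in
/-- The form `B(u, v, w) = ω(∇_u (df v), df w)`. -/
noncomputable def bForm (f : L → M) (p : L) (u v w : TangentSpace (𝓡 n) p) : ℝ :=
  inner ℝ (S.J (f p) (pushDeriv I f p u v)) (mfderiv (𝓡 n) I f p w)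

namespace IsLagrangianImmersion

lemma inner_J_mfderiv (hf : S.IsLagrangianImmersion n f) (u v : TangentSpace (𝓡 n) p) :
    (inner ℝ (S.J (f p) (mfderiv (𝓡 n) I f p u)) (mfderiv (𝓡 n) I f p v) : ℝ) = 0 :=
  hf.fundamentalForm_eq_zero p u v

lemma mdiffAt_pushforward_extend (hf : S.IsLagrangianImmersion n f) (v : TangentSpace (𝓡 n) p) :
    MDifferentiableAt (𝓡 n) I.tangent (fun q => (⟨f q, mfderiv (𝓡 n) I f q
      (FiberBundle.extend (EuclideanSpace ℝ (Fin n)) v q)⟩ : TangentBundle I M)) p :=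
  mdiffAt_pushforward hf.contMDiff (smoothAt_extend v).mdiffAt

lemma psi_add_bForm (hf : S.IsLagrangianImmersion n f) (u v w : TangentSpace (𝓡 n) p) :
    S.psi (f p) (mfderiv (𝓡 n) I f p u) (mfderiv (𝓡 n) I f p v) (mfderiv (𝓡 n) I f p w) +
      S.bForm f p u v w = S.bForm f p u w v := by
  have h := mvfderiv_fundamentalForm_along (S := S) (hf.mdiffAt_pushforward_extend v)
    (hf.mdiffAt_pushforward_extend w) u
  have h0 : (fun q => S.fundamentalForm (f q)
      (mfderiv (𝓡 n) I f q (FiberBundle.extend (EuclideanSpace ℝ (Fin n)) v q))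
      (mfderiv (𝓡 n) I f q (FiberBundle.extend (EuclideanSpace ℝ (Fin n)) w q))) = fun _ => 0 :=
    funext fun q => hf.fundamentalForm_eq_zero q _ _
  rw [h0, mvfderiv_const, S.inner_J_left _ (mfderiv (𝓡 n) I f p _)] at h
  simp only [FiberBundle.extend_apply_self] at h
  change (0 : ℝ) = _ + S.bForm f p u v w + -inner ℝ (mfderiv (𝓡 n) I f p v)
    (S.J (f p) (pushDeriv I f p u w)) at h
  rw [real_inner_comm] at h
  change (0 : ℝ) = _ + S.bForm f p u v w + -S.bForm f p u w v at h
  linarith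

lemma bForm_symm₁₂ (hf : S.IsLagrangianImmersion n f) (u v w : TangentSpace (𝓡 n) p) :
    S.bForm f p u v w = S.bForm f p v u w := by
  rw [bForm, pushDeriv_symm hf.contMDiff, bForm]

/-- A Lagrangian immersion satisfies `f^* ψ = 0`. -/
theorem psi_mfderiv (hf : S.IsLagrangianImmersion n f) (hS : S.IsNearlyKahler)
    (u v w : TangentSpace (𝓡 n) p) : S.psi (f p) (mfderiv (𝓡 n) I f p u)
      (mfderiv (𝓡 n) I f p v) (mfderiv (𝓡 n) I f p w) = 0 := by
  have h1 := hf.psi_add_bForm u v w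
  have h2 := hf.psi_add_bForm v w u
  have h3 := hf.psi_add_bForm w u v
  rw [← hS.psi_rotate] at h2
  rw [hS.psi_rotate] at h3
  linarith [hf.bForm_symm₁₂ u v w, hf.bForm_symm₁₂ u w v, hf.bForm_symm₁₂ v w u]

lemma bForm_symm₂₃ (hf : S.IsLagrangianImmersion n f) (hS : S.IsNearlyKahler)
    (u v w : TangentSpace (𝓡 n) p) : S.bForm f p u v w = S.bForm f p u w v := by
  rw [← hf.psi_add_bForm u v w, hf.psi_mfderiv hS, zero_add]

lemma inner_secondFundamentalForm (hf : S.IsLagrangianImmersion n f)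
    (u v w : TangentSpace (𝓡 n) p) :
    inner ℝ (secondFundamentalForm (I := I) f p u v) (S.J (f p) (mfderiv (𝓡 n) I f p w)) =
      -S.bForm f p u v w := by
  have hw : S.J (f p) (mfderiv (𝓡 n) I f p w) ∈ (tangentPart I n f p)ᗮ := by
    rw [Submodule.mem_orthogonal]
    rintro _ ⟨v, rfl⟩
    rw [real_inner_comm]
    exact hf.inner_J_mfderiv w v
  rw [secondFundamentalForm, Submodule.inner_starProjection_left_eq_right,
    Submodule.starProjection_eq_self_iff.2 hw, bForm, S.inner_J_left, neg_neg]
  rfl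

lemma inner_secondFundamentalForm_tangent (u v w : TangentSpace (𝓡 n) p) :
    inner ℝ (secondFundamentalForm (I := I) f p u v) (mfderiv (𝓡 n) I f p w) = (0 : ℝ) := by
  rw [secondFundamentalForm]
  refine Submodule.inner_left_of_mem_orthogonal (K := tangentPart I n f p) ⟨w, rfl⟩ ?_
  exact Submodule.starProjection_apply_mem _ _

/-- The vectors `df e_i`, `J df e_i` form an orthonormal basis. -/
lemma orthonormal_sumElim (hf : S.IsLagrangianImmersion n f) {e : Fin n → TangentSpace (𝓡 n) p}
    (he : IsOrthonormalFrame (I := I) f p e) :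
    Orthonormal ℝ (Sum.elim (fun i => (mfderiv (𝓡 n) I f p (e i) : TangentSpace I (f p)))
      fun i => S.J (f p) (mfderiv (𝓡 n) I f p (e i))) := by
  have h := orthonormal_iff_ite.1 he
  rw [orthonormal_iff_ite]
  rintro (i | i) (j | j)
  · simpa using h i j
  · simpa [real_inner_comm] using hf.inner_J_mfderiv (e j) (e i)
  · simpa using hf.inner_J_mfderiv (e i) (e j)
  · simpa [S.inner_J_J] using h i j

lemma eq_sum (hf : S.IsLagrangianImmersion n f) {e : Fin n → TangentSpace (𝓡 n) p}
    (he : IsOrthonormalFrame (I := I) f p e) (v : TangentSpace I (f p)) :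
    v = ∑ i, (inner ℝ (mfderiv (𝓡 n) I f p (e i)) v : ℝ) • mfderiv (𝓡 n) I f p (e i) +
      ∑ i, (inner ℝ (S.J (f p) (mfderiv (𝓡 n) I f p (e i))) v : ℝ) •
        S.J (f p) (mfderiv (𝓡 n) I f p (e i)) := by
  have ho := hf.orthonormal_sumElim he
  have hs := ho.linearIndependent.span_eq_top_of_card_eq_finrank' (by
    rw [Fintype.card_sum, Fintype.card_fin]
    exact (two_mul n).symm.trans hf.finrank_eq.symm)
  have h := (OrthonormalBasis.mk ho hs.ge).sum_repr' v
  rw [Fintype.sum_sum_type] at h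
  simpa using h.symm

lemma eq_zero_of_inner (hf : S.IsLagrangianImmersion n f) {e : Fin n → TangentSpace (𝓡 n) p}
    (he : IsOrthonormalFrame (I := I) f p e) {v : TangentSpace I (f p)}
    (h : ∀ i, (inner ℝ v (mfderiv (𝓡 n) I f p (e i)) : ℝ) = 0)
    (h' : ∀ i, (inner ℝ v (S.J (f p) (mfderiv (𝓡 n) I f p (e i))) : ℝ) = 0) : v = 0 := by
  rw [hf.eq_sum he v]
  simp [real_inner_comm v, h, h']

end IsLagrangianImmersion
end AlmostHermitianStructure
end Lagrangian
end NearlyKahler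

namespace NearlyKahler

section Lagrangian

variable {E : Type*} [NormedAddCommGroup E] [NormedSpace ℝ E] [FiniteDimensional ℝ E]
  {H : Type*} [TopologicalSpace H] {I : ModelWithCorners ℝ E H}
  {M : Type*} [TopologicalSpace M] [ChartedSpace H M] [IsManifold I ∞ M]
  {L : Type*} [TopologicalSpace L] [ChartedSpace (EuclideanSpace ℝ (Fin 3)) L]
  [IsManifold (𝓡 3) ∞ L]
  [RiemannianBundle (fun x : M => TangentSpace I x)]
  [IsContMDiffRiemannianBundle I ∞ E (fun x : M => TangentSpace I x)]
  {f : L → M} {p : L} {e : Fin 3 → TangentSpace (𝓡 3) p}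

namespace AlmostHermitianStructure
variable {S : AlmostHermitianStructure I M}

section
variable {x : M} (u v w : TangentSpace I x)

lemma psi_self_J₂₃ : S.psi x u v (S.J x v) = 0 := by
  have h := S.psi_swap₂₃ u v (S.J x v)
  rw [S.psi_J₂] at h
  linarith

lemma IsNearlyKahler.psi_J_swap₁₃ (hS : S.IsNearlyKahler) :
    S.psi x u v (S.J x w) = -S.psi x w v (S.J x u) := by
  rw [← hS.psi_J₁, hS.psi_rotate, hS.psi_rotate, S.psi_swap₂₃]

lemma IsNearlyKahler.psi_self_J₁₃ (hS : S.IsNearlyKahler) : S.psi x u v (S.J x u) = 0 := by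
  linarith [hS.psi_J_swap₁₃ u v u]

lemma IsNearlyKahler.psi_J_rotate (hS : S.IsNearlyKahler) :
    S.psi x u v (S.J x w) = S.psi x v w (S.J x u) := by
  rw [← hS.psi_J₁, hS.psi_rotate]

end

namespace IsLagrangianImmersion

lemma covJ_frame (hf : S.IsLagrangianImmersion 3 f) (hS : S.IsNearlyKahler)
    (he : IsOrthonormalFrame (I := I) f p e) {i j k : Fin 3} (hik : i ≠ k) (hjk : j ≠ k)
    (hij : i ≠ j) :
    S.covJ (f p) (mfderiv (𝓡 3) I f p (e j)) (mfderiv (𝓡 3) I f p (e i)) =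
      S.psi (f p) (mfderiv (𝓡 3) I f p (e i)) (mfderiv (𝓡 3) I f p (e j))
        (S.J (f p) (mfderiv (𝓡 3) I f p (e k))) • S.J (f p) (mfderiv (𝓡 3) I f p (e k)) := by
  have ho := orthonormal_iff_ite.1 he
  rw [← sub_eq_zero]
  refine hf.eq_zero_of_inner he (fun l => ?_) fun l => ?_
  · rw [inner_sub_left, real_inner_smul_left, hf.inner_J_mfderiv, mul_zero, sub_zero]
    exact hf.psi_mfderiv hS _ _ _
  · rw [inner_sub_left, real_inner_smul_left, S.inner_J_J, ho k l]
    change S.psi _ _ _ _ - _ = 0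
    obtain rfl | rfl | rfl : l = i ∨ l = j ∨ l = k := by omega
    · rw [hS.psi_self_J₁₃, if_neg hik.symm, mul_zero, sub_zero]
    · rw [psi_self_J₂₃, if_neg hjk.symm, mul_zero, sub_zero]
    · rw [if_pos rfl, mul_one, sub_self]

lemma psi_frame_ne_zero (hf : S.IsLagrangianImmersion 3 f) (hS : S.IsStrictNearlyKahler)
    (he : IsOrthonormalFrame (I := I) f p e) {i j k : Fin 3} (hik : i ≠ k) (hjk : j ≠ k)
    (hij : i ≠ j) :
    S.psi (f p) (mfderiv (𝓡 3) I f p (e i)) (mfderiv (𝓡 3) I f p (e j))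
      (S.J (f p) (mfderiv (𝓡 3) I f p (e k))) ≠ 0 := by
  intro h
  have h1 := hf.covJ_frame hS.1 he hik hjk hij
  have h2 := hf.covJ_frame hS.1 he hjk.symm hij hik.symm
  rw [← hS.1.psi_J_rotate, ← hS.1.psi_J_rotate, h, zero_smul, hS.1.covJ_swap, neg_eq_zero] at h2
  rw [h, zero_smul] at h1
  obtain ⟨w, hw⟩ := hS.2 (f p) (mfderiv (𝓡 3) I f p (e i)) (he.ne_zero i)
  have h3 : ∀ l, S.covJ (f p) (mfderiv (𝓡 3) I f p (e l)) (mfderiv (𝓡 3) I f p (e i)) = 0 := by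
    intro l
    obtain rfl | rfl | rfl : l = i ∨ l = j ∨ l = k := by omega
    exacts [hS.1 _ _, h1, h2]
  refine hw ?_
  rw [hf.eq_sum he w]
  simp [covJ_J, h3]

lemma sum_bForm_distinct (hf : S.IsLagrangianImmersion 3 f) (hS : S.IsStrictNearlyKahler)
    (he : IsOrthonormalFrame (I := I) f p e) {i j k : Fin 3} (hik : i ≠ k) (hjk : j ≠ k)
    (hij : i ≠ j) :
    S.bForm f p (e i) (e i) (e i) + S.bForm f p (e i) (e j) (e j) +
      S.bForm f p (e i) (e k) (e k) = 0 := by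
  have hXY := hf.covJ_frame hS.1 he hik hjk hij
  have hYZ := hf.covJ_frame hS.1 he hij.symm hik.symm hjk
  have hZX := hf.covJ_frame hS.1 he hjk.symm hij hik.symm
  rw [← hS.1.psi_J_rotate] at hYZ
  rw [← hS.1.psi_J_rotate, ← hS.1.psi_J_rotate] at hZX
  have hc := hf.psi_frame_ne_zero hS he hik hjk hij
  set c := S.psi (f p) (mfderiv (𝓡 3) I f p (e i)) (mfderiv (𝓡 3) I f p (e j))
    (S.J (f p) (mfderiv (𝓡 3) I f p (e k)))
  have h := (hS.1.mvfderiv_psi_along (hf.mdiffAt_pushforward_extend (e i))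
    (hf.mdiffAt_pushforward_extend (e j)) (hf.mdiffAt_pushforward_extend (e k)) (e i)).2
  have h0 : (fun q => S.psi (f q)
      (mfderiv (𝓡 3) I f q (FiberBundle.extend (EuclideanSpace ℝ (Fin 3)) (e i) q))
      (mfderiv (𝓡 3) I f q (FiberBundle.extend (EuclideanSpace ℝ (Fin 3)) (e j) q))
      (mfderiv (𝓡 3) I f q (FiberBundle.extend (EuclideanSpace ℝ (Fin 3)) (e k) q))) =
        fun _ => 0 := funext fun q => hf.psi_mfderiv hS.1 _ _ _
  have h1 : S.covPsiAt (f p) (mfderiv (𝓡 3) I f p (e i)) (mfderiv (𝓡 3) I f p (e i))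
      (mfderiv (𝓡 3) I f p (e j)) (mfderiv (𝓡 3) I f p (e k)) = 0 := by
    refine hS.1.covPsi_eq_zero (smoothAt_extend _) (smoothAt_extend _) (smoothAt_extend _)
      (c := c) ?_ ?_ ?_ <;> simpa only [FiberBundle.extend_apply_self]
  have hB : ∀ l, inner ℝ (S.J (f p) (mfderiv (𝓡 3) I f p (e l))) (pushDeriv I f p (e i) (e l)) =
      -S.bForm f p (e i) (e l) (e l) := fun l => by
    rw [S.inner_J_left, bForm, real_inner_comm]
  rw [h0, mvfderiv_const] at h
  simp only [FiberBundle.extend_apply_self] at h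
  change 0 = _ + S.psi _ (pushDeriv I f p (e i) (e i)) _ _ +
    S.psi _ _ (pushDeriv I f p (e i) (e j)) _ + S.psi _ _ _ (pushDeriv I f p (e i) (e k)) at h
  rw [h1, zero_add, hS.1.psi_rotate (pushDeriv I f p (e i) (e i)),
    ← hS.1.psi_rotate (mfderiv (𝓡 3) I f p (e k)), psi, psi, psi, hXY, hYZ, hZX,
    real_inner_smul_left, real_inner_smul_left, real_inner_smul_left, hB, hB, hB, ← mul_add,
    ← mul_add, zero_eq_mul] at h
  linarith [h.resolve_left hc]

lemma sum_bForm_frame (hf : S.IsLagrangianImmersion 3 f) (hS : S.IsStrictNearlyKahler)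
    (he : IsOrthonormalFrame (I := I) f p e) (k : Fin 3) :
    ∑ i, S.bForm f p (e i) (e i) (e k) = 0 := by
  have h : ∀ i, S.bForm f p (e i) (e i) (e k) = S.bForm f p (e k) (e i) (e i) := fun i => by
    rw [hf.bForm_symm₂₃ hS.1, hf.bForm_symm₁₂]
  simp only [h, Fin.sum_univ_three]
  obtain rfl | rfl | rfl : k = 0 ∨ k = 1 ∨ k = 2 := by omega
  · linarith [hf.sum_bForm_distinct hS he (i := 0) (j := 1) (k := 2) (by decide) (by decide)
      (by decide)]
  · linarith [hf.sum_bForm_distinct hS he (i := 1) (j := 0) (k := 2) (by decide) (by decide)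
      (by decide)]
  · linarith [hf.sum_bForm_distinct hS he (i := 2) (j := 0) (k := 1) (by decide) (by decide)
      (by decide)]

theorem meanCurvature_eq_zero (hf : S.IsLagrangianImmersion 3 f) (hS : S.IsStrictNearlyKahler)
    (he : IsOrthonormalFrame (I := I) f p e) : meanCurvature (I := I) f p e = 0 := by
  refine hf.eq_zero_of_inner he (fun k => ?_) fun k => ?_
  · simp [meanCurvature, sum_inner, inner_secondFundamentalForm_tangent]
  · simp [meanCurvature, sum_inner, hf.inner_secondFundamentalForm, hf.sum_bForm_frame hS he]

theorem alphaTensor_eq_zero (hf : S.IsLagrangianImmersion 3 f) (hS : S.IsStrictNearlyKahler)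
    (he : IsOrthonormalFrame (I := I) f p e) (u v : TangentSpace (𝓡 3) p) :
    S.alphaTensor f p e u v = 0 := by
  have hT : ∀ i, S.cTensor f p (e i) u (S.canonicalTorsion (f p) (mfderiv (𝓡 3) I f p (e i))
      (mfderiv (𝓡 3) I f p v)) = -∑ k, S.psi (f p) (mfderiv (𝓡 3) I f p (e i))
        (mfderiv (𝓡 3) I f p v) (S.J (f p) (mfderiv (𝓡 3) I f p (e k))) *
          S.bForm f p (e i) u (e k) := fun i => by
    have h := hf.eq_sum he
      (S.covJ (f p) (mfderiv (𝓡 3) I f p v) (mfderiv (𝓡 3) I f p (e i)))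
    have h0 : ∀ k, inner ℝ (mfderiv (𝓡 3) I f p (e k))
        (S.covJ (f p) (mfderiv (𝓡 3) I f p v) (mfderiv (𝓡 3) I f p (e i))) = (0 : ℝ) := fun k => by
      rw [real_inner_comm]
      exact hf.psi_mfderiv hS.1 _ _ _
    simp only [h0, zero_smul, Finset.sum_const_zero, zero_add] at h
    rw [cTensor, canonicalTorsion_apply _ _ _ hS.1, map_neg, S.J_J, neg_neg, h, inner_sum,
      ← Finset.sum_neg_distrib]
    refine Finset.sum_congr rfl fun k _ => ?_
    rw [real_inner_smul_right, hf.inner_secondFundamentalForm, real_inner_comm, psi, mul_neg]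
  have hp : ∀ i k, S.psi (f p) (mfderiv (𝓡 3) I f p (e i)) (mfderiv (𝓡 3) I f p v)
      (S.J (f p) (mfderiv (𝓡 3) I f p (e k))) * S.bForm f p (e i) u (e k) =
      -(S.psi (f p) (mfderiv (𝓡 3) I f p (e k)) (mfderiv (𝓡 3) I f p v)
        (S.J (f p) (mfderiv (𝓡 3) I f p (e i))) * S.bForm f p (e k) u (e i)) := fun i k => by
    rw [hS.1.psi_J_swap₁₃, hf.bForm_symm₂₃ hS.1, hf.bForm_symm₁₂, hf.bForm_symm₂₃ hS.1, neg_mul]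
  have hs := Finset.sum_comm (s := Finset.univ) (t := Finset.univ) (f := fun i k =>
    S.psi (f p) (mfderiv (𝓡 3) I f p (e i)) (mfderiv (𝓡 3) I f p v)
      (S.J (f p) (mfderiv (𝓡 3) I f p (e k))) * S.bForm f p (e i) u (e k))
  have hs' := Finset.sum_congr (s₁ := Finset.univ) rfl fun i _ =>
    Finset.sum_congr (s₁ := Finset.univ) rfl fun k _ => hp k i
  simp only [Finset.sum_neg_distrib] at hs'
  rw [alphaTensor, Finset.sum_congr rfl fun i _ => hT i, Finset.sum_neg_distrib, neg_eq_zero]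
  linarith

end IsLagrangianImmersion
end AlmostHermitianStructure
end Lagrangian
end NearlyKahler

namespace NearlyKahler

section Orientable

variable {E : Type*} [NormedAddCommGroup E] [NormedSpace ℝ E] [FiniteDimensional ℝ E]
  {H : Type*} [TopologicalSpace H] {I : ModelWithCorners ℝ E H}
  {M : Type*} [TopologicalSpace M] [ChartedSpace H M] [IsManifold I ∞ M]
  {L : Type*} [TopologicalSpace L] [ChartedSpace (EuclideanSpace ℝ (Fin 3)) L]
  [IsManifold (𝓡 3) ∞ L]
  [RiemannianBundle (fun x : M => TangentSpace I x)]
  [IsContMDiffRiemannianBundle I ∞ E (fun x : M => TangentSpace I x)]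
  {f : L → M} {p : L}

namespace AlmostHermitianStructure
variable {S : AlmostHermitianStructure I M}

/-- The volume form `ψ(df u, df v, J df w)`. -/
noncomputable def IsNearlyKahler.volumeForm (hS : S.IsNearlyKahler) (f : L → M) (p : L) :
    TangentSpace (𝓡 3) p [⋀^Fin 3]→ₗ[ℝ] ℝ where
  toFun v := S.psi (f p) (mfderiv (𝓡 3) I f p (v 0)) (mfderiv (𝓡 3) I f p (v 1))
    (S.J (f p) (mfderiv (𝓡 3) I f p (v 2)))
  map_update_add' := by
    intro d m i u v
    obtain rfl : d = instDecidableEqFin 3 := Subsingleton.elim _ _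
    obtain rfl | rfl | rfl : i = 0 ∨ i = 1 ∨ i = 2 := by omega
    all_goals simp [psi_add₁, psi_add₂, psi_add₃]
  map_update_smul' := by
    intro d m i c u
    obtain rfl : d = instDecidableEqFin 3 := Subsingleton.elim _ _
    obtain rfl | rfl | rfl : i = 0 ∨ i = 1 ∨ i = 2 := by omega
    all_goals simp [psi_smul₁, psi_smul₂, psi_smul₃]
  map_eq_zero_of_eq' v i j h hij := by
    have h' : v 0 = v 1 ∨ v 0 = v 2 ∨ v 1 = v 2 := by
      obtain rfl | rfl | rfl : i = 0 ∨ i = 1 ∨ i = 2 := by omega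
      all_goals obtain rfl | rfl | rfl : j = 0 ∨ j = 1 ∨ j = 2 := by omega
      all_goals simp_all
    rcases h' with h' | h' | h' <;> rw [h']
    exacts [hS.psi_self₁₂ _ _, hS.psi_self_J₁₃ _ _, psi_self_J₂₃ _ _]

namespace IsLagrangianImmersion

lemma volumeForm_ne_zero (hf : S.IsLagrangianImmersion 3 f) (hS : S.IsStrictNearlyKahler) (p : L) :
    hS.1.volumeForm f p ≠ 0 := by
  obtain ⟨e, he⟩ := exists_isOrthonormalFrame (hf.injective_mfderiv p)
  intro h
  refine hf.psi_frame_ne_zero hS he (i := 0) (j := 1) (k := 2) (by decide) (by decide)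
    (by decide) ?_
  exact DFunLike.congr_fun h e

lemma orientation_eq_iff (hf : S.IsLagrangianImmersion 3 f) (hS : S.IsStrictNearlyKahler)
    (b : Module.Basis (Fin 3) ℝ (TangentSpace (𝓡 3) p)) :
    b.orientation = rayOfNeZero ℝ (hS.1.volumeForm f p) (hf.volumeForm_ne_zero hS p) ↔
      0 < hS.1.volumeForm f p b := by
  have h0 : hS.1.volumeForm f p b ≠ 0 := fun h => hf.volumeForm_ne_zero hS p (by
    rw [(hS.1.volumeForm f p).eq_smul_basis_det b, h, zero_smul])
  rw [Module.Basis.orientation, ray_eq_iff]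
  nth_rw 1 [(hS.1.volumeForm f p).eq_smul_basis_det b]
  exact sameRay_smul_right_iff_of_ne b.det_ne_zero h0

lemma continuousAt_volumeForm (hf : S.IsLagrangianImmersion 3 f) (hS : S.IsNearlyKahler)
    {s : Fin 3 → Π q : L, TangentSpace (𝓡 3) q}
    (hs : ∀ i, MDifferentiableAt (𝓡 3) (𝓡 3).tangent
      (fun q => (⟨q, s i q⟩ : TangentBundle (𝓡 3) L)) p) :
    ContinuousAt (fun q => hS.volumeForm f q fun i => s i q) p := by
  have h := fun i => mdiffAt_pushforward hf.contMDiff (hs i)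
  have hJ := ((S.contMDiff_J (f p)).mdifferentiableAt (by simp)).comp p
    (hf.contMDiff.mdifferentiable (by simp) p)
  exact (hS.mvfderiv_psi_along (h 0) (h 1) (hJ.clm_bundle_apply (h 2)) 0).1.continuousAt

theorem isOrientable (hf : S.IsLagrangianImmersion 3 f) (hS : S.IsStrictNearlyKahler) :
    IsOrientable 3 L := by
  let o : Π p : L, Orientation ℝ (TangentSpace (𝓡 3) p) (Fin 3) := fun p =>
    rayOfNeZero ℝ (hS.1.volumeForm f p) (hf.volumeForm_ne_zero hS p)
  refine ⟨o, fun p => ?_⟩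
  let t := trivializationAt (EuclideanSpace ℝ (Fin 3)) (fun q : L => TangentSpace (𝓡 3) q) p
  have hp : p ∈ t.baseSet := FiberBundle.mem_baseSet_trivializationAt _ _ p
  let b := (((t.basisAt (EuclideanSpace.basisFun (Fin 3) ℝ).toBasis hp).adjustToOrientation
    (o p)).map (t.linearEquivAt ℝ p hp))
  have hs := t.isLocalFrameOn_localFrame_baseSet (𝓡 3) ∞ b
  have hpos : 0 < hS.1.volumeForm f p fun i => t.localFrame b i p := by
    have e : (fun i => t.localFrame b i p) = (t.basisAt (EuclideanSpace.basisFun (Fin 3)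
        ℝ).toBasis hp).adjustToOrientation (o p) := by
      ext1 i
      rw [t.localFrame_apply_of_mem_baseSet b hp]
      simp [Trivialization.basisAt, b, t.symm_apply_apply_mk hp]
    rw [e, ← hf.orientation_eq_iff hS]
    exact Module.Basis.orientation_adjustToOrientation _ _
  have hc := hf.continuousAt_volumeForm hS.1 (p := p) (s := t.localFrame b) fun i =>
    (hs.contMDiffAt t.open_baseSet hp i).mdifferentiableAt (by simp)
  obtain ⟨u, hu, huo, hpu⟩ := eventually_nhds_iff.1
    ((hc.eventually_const_lt hpos).and (t.open_baseSet.mem_nhds hp))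
  refine ⟨u, huo, hpu, t.localFrame b, hs.mono fun q hq => (hu q hq).2, fun q hq => ?_⟩
  rw [hf.orientation_eq_iff hS, funext (IsLocalFrameOn.toBasisAt_coe _ hq)]
  exact (hu q hq).1

end IsLagrangianImmersion
end AlmostHermitianStructure
end Orientable
end NearlyKahler

theorem mainTheorem1
    {M : Type*} [TopologicalSpace M] [ChartedSpace (EuclideanSpace ℝ (Fin 6)) M]
    [IsManifold (𝓡 6) ∞ M]
    [RiemannianBundle (fun x : M => TangentSpace (𝓡 6) x)]
    [IsContMDiffRiemannianBundle (𝓡 6) ∞ (EuclideanSpace ℝ (Fin 6))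
      (fun x : M => TangentSpace (𝓡 6) x)]
    (S : NearlyKahler.AlmostHermitianStructure (𝓡 6) M) (hS : S.IsStrictNearlyKahler)
    {L : Type*} [TopologicalSpace L] [ChartedSpace (EuclideanSpace ℝ (Fin 3)) L]
    [IsManifold (𝓡 3) ∞ L]
    (f : L → M) (hf : S.IsLagrangianImmersion 3 f) :
    (∀ (p : L) (e : Fin 3 → TangentSpace (𝓡 3) p),
      NearlyKahler.IsOrthonormalFrame (I := 𝓡 6) f p e →
        (∀ X Y : TangentSpace (𝓡 3) p, S.alphaTensor f p e X Y = 0) ∧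
          NearlyKahler.meanCurvature (I := 𝓡 6) f p e = 0) ∧
      NearlyKahler.IsOrientable 3 L ∧ NearlyKahler.IsMinimal (𝓡 6) 3 f := by
  have h : NearlyKahler.IsMinimal (𝓡 6) 3 f := fun _ _ he => hf.meanCurvature_eq_zero hS he
  exact ⟨fun p e he => ⟨hf.alphaTensor_eq_zero hS he, h p e he⟩, hf.isOrientable hS, h⟩
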